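/- Setting. Let $H\in\mathbb F_2^{m\times n}$ be a parity-check matrix with $n\ge 1$ columns, and let $\mathcal G=(\mathcal V,\mathcal C,\mathcal E)$ be its Tanner graph: the bipartite graph with $n$ variable nodes and $m$ check nodes in which variable node $v$ and check node $c$ are adjacent if and only if $H_{c,v}=1$. For a set $\varepsilon$ of (erased) variable nodes let $\mathcal G'$ be the variable-induced subgraph, i.e. the subgraph of $\mathcal G$ induced by $\varepsilon$ and all check nodes adjacent to an element of $\varepsilon$. A *cluster* of $\mathcal G'$ is a biconnected component (a maximal set of nodes whose induced subgraph is connected and has no articulation point; an isolated node and the two ends of a bridge count), its *size* is its number of variable nodes, and the *cluster forest* is the forest of clusters and articulation points (cut nodes) of $\mathcal G'$, each tree being rooted at one of its clusters. Algorithm. Given $\mathcal G'$ (by adjacency lists), a syndrome $s\in\mathbb F_2^m$ and an integer $C\ge 0$, cluster decomposition post-processing with constrained cluster sizes proceeds as follows. 1. Compute the rooted cluster forest of $\mathcal G'$ by the depth-first search algorithm of Hopcroft and Tarjan. 2. If some cluster has size larger than $C$, stop and declare failure. 3. For every tree, recursively from the leaves to the root, set up for each cluster $B$ the linear system over $\mathbb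 F_2$ in the values of its variable nodes, consisting of: the syndrome equations of the check nodes of $B$ that are not cut nodes; for every child variable cut node with a frozen child cluster, the equation giving it the frozen value; for every child check cut node all of whose child clusters are frozen, the equation requiring from $B$ the contribution that, added to the frozen contributions, gives the syndrome bit. Solve it by Gaussian elimination: once if $B$ is a root; otherwise twice, with the value of (or the contribution of $B$ to) its parent cut node prescribed to be $0$ and $1$. Store the solutions, and label $B$ free if both exist and frozen otherwise. 4. For every tree, recursively from the root to the leaves, select for each cluster its only solution (root or frozen cluster), or the stored solution that agrees with the bit required at the parent cut node (free cluster). Below a variable cut node the required bit is its value in the parent cluster; below a check cut node the first free child cluster gets the bit still missing for the syndrome, and the other free ones get $0$. 5. Merge the selected solutions into one vector $\widehat x'\in\mathbb F_2^n$ and return it. Theorem. Assume that the number of edges of the Tanner graph is linear in $n$, i.e. $|\mathcal E|\le Kn$ for a constant $K$. Then the time complexity of this algorithm on a unit-cost random access machine is $O(nC^2)+O(n)$: for every $K$ there are constants $A,A'$, depending only on $K$, such that for all $n\ge1$, $m$, $H$ with $|\mathcal E|\le Kn$, $\varepsilon$, $s$ and $C$, the algorithm terminates after at most $A\,nC^2+A'\,n$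 steps. -/

import Mathlib

/-! ## Tanner graphs and their variable-induced subgraphs -/

/-- Nodes of a Tanner graph: variable nodes `Sum.inl v` and check nodes `Sum.inr c`. -/
abbrev Node (n m : ℕ) := Fin n ⊕ Fin m

/-- Bits, with arithmetic modulo `2`. -/
abbrev Bit := ZMod 2

/-- The Tanner graph of a parity-check matrix: the variable node `v` and the check node `c` are
joined exactly when the entry of `H` in row `c` and column `v` is `1`. -/
def tannerGraph {n m : ℕ} (H : Matrix (Fin m) (Fin n) Bit) : SimpleGraph (Node n m) where
  Adj a b := (∃ v c, a = Sum.inl v ∧ b = Sum.inr c ∧ H c v = 1) ∨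
    (∃ v c, a = Sum.inr c ∧ b = Sum.inl v ∧ H c v = 1)
  symm := ⟨by
    rintro a b (⟨v, c, ha, hb, h⟩ | ⟨v, c, ha, hb, h⟩)
    · exact Or.inr ⟨v, c, hb, ha, h⟩
    · exact Or.inl ⟨v, c, hb, ha, h⟩⟩
  loopless := ⟨by
    rintro a (⟨v, c, ha, hb, -⟩ | ⟨v, c, ha, hb, -⟩) <;> simp [ha] at hb⟩

/-- The variable-induced subgraph of a set `ε` of variable nodes: the subgraph induced by the
variable nodes in `ε` together with all check nodes that are joined to one of them. -/
def variableInduced {n m : ℕ} (H : Matrix (Fin m) (Fin n) Bit) (ε : Finset (Fin n)) :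
    (tannerGraph H).Subgraph :=
  (⊤ : (tannerGraph H).Subgraph).induce
    ({a | ∃ v ∈ ε, a = Sum.inl v} ∪ {a | ∃ v ∈ ε, (tannerGraph H).Adj (Sum.inl v) a})

/-- The data structure in which a graph is given to an algorithm: a list of its nodes and, for
every node, the list of its neighbours. -/
structure AdjList (V : Type*) where
  nodes : List V
  nbrs : V → List V

/-- `L` is an adjacency-list representation of the graph `G'` (in any order). -/
structure AdjList.Represents {V : Type*} {G : SimpleGraph V} (L : AdjList V) (G' : G.Subgraph) :
    Prop where
  nodes_nodup : L.nodes.Nodup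
  mem_nodes : ∀ a, a ∈ L.nodes ↔ a ∈ G'.verts
  nbrs_nodup : ∀ a, (L.nbrs a).Nodup
  mem_nbrs : ∀ a b, b ∈ L.nbrs a ↔ G'.Adj a b

/-! ## Machine model

A random access machine with unit cost.  A computation of type `RAM n m α` transforms the memory and
returns a value of type `α`, or it does not terminate (`none`).  The memory consists of arrays,
registers and pointers to linked lists; the field `time` counts the executed steps.  Every access to
a memory cell goes through `rd` or `wr`, and each of them costs one step.  Every pass through a loop
and every call of a procedure that recurses on a list is charged at least one step (by `tick`, `rd`
or `wr`), so that between two charges only a bounded number of elementary operations (comparison,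
addition, following a pointer to the neighbour list of a node, forming or taking
apart one list cell or one record) is carried out. -/

/-- A cluster, that is, a biconnected component: the list of its variable nodes and the list of its
check nodes, each check node together with the list of its neighbours inside the cluster. -/
structure Cluster (n m : ℕ) where
  vars : List (Fin n)
  checks : List (Fin m × List (Fin n))

/-- An edge on the stack of the depth-first search: it was traversed from `src` to `dst`, and it is
either a tree edge or a back edge. -/
structure StackEdge (n m : ℕ) where
  src : Node n m
  dst : Node n m
  tree : Bool

structure Mem (n m : ℕ) where
  /-- number of steps executed so far -/
  time : ℕ
  /-- number of nodes discovered so far by the depth-first search -/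
  clock : ℕ
  /-- discovery number, `0` for nodes that are not yet discovered -/
  num : Node n m → ℕ
  /-- low point -/
  low : Node n m → ℕ
  /-- stack of traversed edges which are not yet assigned to a cluster -/
  stack : List (StackEdge n m)
  /-- neighbours of a check node inside the cluster that is being built -/
  nb : Fin m → List (Fin n)
  /-- number of clusters found so far; they are numbered from `0` -/
  cnt : ℕ
  /-- the clusters -/
  cluster : ℕ → Cluster n m
  /-- child clusters of a node in the rooted cluster forest; a node which is not the parent of a
  cluster (such as a node that is not an articulation point) has none -/
  kids : Node n m → List ℕ
  /-- the root cluster of every tree of the forest -/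
  roots : List ℕ
  /-- scratch space for writing down rows of a linear system -/
  mark : Fin n → Bit
  /-- stored solution with value (or contribution) `0` at the parent; for a root the only one -/
  sol0 : ℕ → Option (List Bit)
  /-- stored solution with value (or contribution) `1` at the parent -/
  sol1 : ℕ → Option (List Bit)
  /-- label of a cluster: `none` if it is free for its parent, `some b` if it is frozen to `b` -/
  label : ℕ → Option Bit
  /-- values of the variable nodes in the solution selected last -/
  val : Fin n → Bit
  /-- the selected solution of every cluster -/
  chosen : ℕ → List (Fin n × Bit)
  /-- output vector -/
  out : Fin n → Bit

/-- The memory at the start. -/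
def Mem.blank (n m : ℕ) : Mem n m where
  time := 0
  clock := 0
  num := fun _ => 0
  low := fun _ => 0
  stack := []
  nb := fun _ => []
  cnt := 0
  cluster := fun _ => ⟨[], []⟩
  kids := fun _ => []
  roots := []
  mark := fun _ => 0
  sol0 := fun _ => none
  sol1 := fun _ => none
  label := fun _ => none
  val := fun _ => 0
  chosen := fun _ => []
  out := fun _ => 0

/-- Computations. -/
abbrev RAM (n m : ℕ) (α : Type) := StateT (Mem n m) Option α

namespace RAM

variable {n m : ℕ}

/-- One step without access to the memory. -/
def tick : RAM n m Unit := fun s => some ((), { s with time := s.time + 1 })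

/-- One step which reads the memory cell selected by `f`. -/
def rd {α : Type} (f : Mem n m → α) : RAM n m α := fun s => some (f s, { s with time := s.time + 1 })

/-- One step which overwrites a memory cell, as described by `f`. -/
def wr (f : Mem n m → Mem n m) : RAM n m Unit :=
  fun s => some ((), { f s with time := s.time + 1 })

/-- Started on blank memory, the computation `p` terminates with the value `a` after exactly `t`
steps. -/
def HaltsIn {α : Type} (p : RAM n m α) (a : α) (t : ℕ) : Prop :=
  ∃ s : Mem n m, p (Mem.blank n m) = some (a, s) ∧ s.time = t

/-! ## Cluster forest: the algorithm of Hopcroft and Tarjan -/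

/-- Discover the node `w`. -/
def discover (w : Node n m) : RAM n m Unit := do
  let k ← rd (·.clock)
  wr fun s => { s with clock := k + 1 }
  wr fun s => { s with num := Function.update s.num w (k + 1) }
  wr fun s => { s with low := Function.update s.low w (k + 1) }

/-- Push an edge. -/
def push (e : StackEdge n m) : RAM n m Unit := do
  let st ← rd (·.stack)
  wr fun s => { s with stack := e :: st }

/-- `low v := min (low v) k`. -/
def lower (v : Node n m) (k : ℕ) : RAM n m Unit := do
  let l ← rd (·.low v)
  wr fun s => { s with low := Function.update s.low v (min l k) }

/-- Enter the edge with end nodes `a`, `b` into the neighbour list of its check node. -/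
def recordEdge : Node n m → Node n m → RAM n m Unit
  | .inl v, .inr c => do
    let l ← rd (·.nb c)
    wr fun s => { s with nb := Function.update s.nb c (v :: l) }
  | .inr c, .inl v => do
    let l ← rd (·.nb c)
    wr fun s => { s with nb := Function.update s.nb c (v :: l) }
  | _, _ => tick

/-- Add the node `a` to the node lists of a cluster. -/
def addNode (a : Node n m) (acc : List (Fin n) × List (Fin m)) : List (Fin n) × List (Fin m) :=
  match a with
  | .inl v => (v :: acc.1, acc.2)
  | .inr c => (acc.1, c :: acc.2)

/-- Take edges from the stack up to and including the tree edge from `v` to `w`, and record them.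
Every node of the cluster other than `v` is the end of exactly one of its tree edges.  Returns the
nodes and the remaining stack. -/
def popCluster (v w : Node n m) : List (StackEdge n m) → List (Fin n) × List (Fin m) →
    RAM n m ((List (Fin n) × List (Fin m)) × List (StackEdge n m))
  | [], acc => do
    tick
    pure (acc, [])
  | e :: st, acc => do
    tick
    recordEdge e.src e.dst
    if e.tree then
      if e.src = v ∧ e.dst = w then
        pure (addNode e.dst acc, st)
      else
        popCluster v w st (addNode e.dst acc)
    else
      popCluster v w st acc

/-- Fetch the neighbour lists of the given check nodes, and reset them. -/
def collectChecks : List (Fin m) → RAM n m (List (Fin m × List (Fin n)))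
  | [] => do
    tick
    pure []
  | c :: cs => do
    tick
    let l ← rd (·.nb c)
    wr fun s => { s with nb := Function.update s.nb c [] }
    let r ← collectChecks cs
    pure ((c, l) :: r)

/-- Store a new cluster, and return its number. -/
def newCluster (acc : List (Fin n) × List (Fin m)) : RAM n m ℕ := do
  let checks ← collectChecks acc.2
  let B ← rd (·.cnt)
  wr fun s => { s with cnt := B + 1 }
  wr fun s => { s with cluster := Function.update s.cluster B ⟨acc.1, checks⟩ }
  pure B

/-- The edges on the stack down to the tree edge from `v` to `w` form a cluster, whose parent is the
node `v`. -/
def closeCluster (v w : Node n m) : RAM n m Unit := do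
  let st ← rd (·.stack)
  let r ← popCluster v w st (addNode v ([], []))
  wr fun s => { s with stack := r.2 }
  let B ← newCluster r.1
  let ks ← rd (·.kids v)
  wr fun s => { s with kids := Function.update s.kids v (B :: ks) }

/-- Depth-first search at the node `v`, which was entered from `u` (`none` at the start); the last
argument is the part of the neighbour list of `v` that has not been treated yet. -/
def scan (G : AdjList (Node n m)) (u : Option (Node n m)) (v : Node n m)
    (ws : List (Node n m)) : RAM n m Unit :=
  match ws with
  | [] => tick
  | w :: ws => do
    tick
    let numV ← rd (·.num v)
    let numW ← rd (·.num w)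
    if numW = 0 then
      push ⟨v, w, true⟩
      discover w
      scan G (some v) w (G.nbrs w)
      let lowW ← rd (·.low w)
      lower v lowW
      if numV ≤ lowW then
        closeCluster v w
    else if numW < numV ∧ u ≠ some w then
      push ⟨v, w, false⟩
      lower v numW
    scan G u v ws
  partial_fixpoint

/-- Choose a root cluster for the tree explored from `r`.  An isolated node is a cluster by itself.
Otherwise one cluster at `r` becomes the root, and further clusters at `r` become its descendants
below the cut node `r`. -/
def chooseRoot (r : Node n m) : RAM n m Unit := do
  let ks ← rd (·.kids r)
  let rts ← rd (·.roots)
  match ks with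
  | [] => do
    let B ← newCluster (addNode r ([], []))
    wr fun s => { s with roots := B :: rts }
  | B :: ks => do
    wr fun s => { s with kids := Function.update s.kids r ks }
    wr fun s => { s with roots := B :: rts }

/-- Explore all connected components which contain a node of the list. -/
def explore (G : AdjList (Node n m)) : List (Node n m) → RAM n m Unit
  | [] => tick
  | r :: rs => do
    tick
    let k ← rd (·.num r)
    if k = 0 then
      discover r
      scan G none r (G.nbrs r)
      chooseRoot r
    explore G rs

/-- Set up the array cells which belong to a node. -/
def allocate : Node n m → RAM n m Unit
  | .inl v => do
    wr fun s => { s with num := Function.update s.num (.inl v) 0 }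
    wr fun s => { s with low := Function.update s.low (.inl v) 0 }
    wr fun s => { s with kids := Function.update s.kids (.inl v) [] }
    wr fun s => { s with mark := Function.update s.mark v 0 }
    wr fun s => { s with val := Function.update s.val v 0 }
  | .inr c => do
    wr fun s => { s with num := Function.update s.num (.inr c) 0 }
    wr fun s => { s with low := Function.update s.low (.inr c) 0 }
    wr fun s => { s with kids := Function.update s.kids (.inr c) [] }
    wr fun s => { s with nb := Function.update s.nb c [] }

/-- Decompose the graph `G` into a rooted cluster forest. -/
def clusterForest (G : AdjList (Node n m)) : RAM n m Unit := do
  G.nodes.forM allocate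
  explore G G.nodes

/-! ## Gaussian elimination -/

/-- Search the equations (coefficients, right-hand side) for one with leading coefficient `1`;
returns it with the remaining equations. -/
def findPivot : List (List Bit × Bit) → RAM n m (Option (List Bit × Bit) × List (List Bit × Bit))
  | [] => do
    tick
    pure (none, [])
  | e :: es => do
    tick
    match e with
    | (a :: r, b) =>
      if a = 1 then
        pure (some (r, b), es)
      else do
        let q ← findPivot es
        pure (q.1, e :: q.2)
    | ([], _) => do
      let q ← findPivot es
      pure (q.1, e :: q.2)

/-- Sum of two vectors. -/
def addVec : List Bit → List Bit → RAM n m (List Bit)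
  | a :: r, b :: t => do
    tick
    let q ← addVec r t
    pure ((a + b) :: q)
  | _, _ => do
    tick
    pure []

/-- Scalar product of two vectors. -/
def dotVec : List Bit → List Bit → RAM n m Bit
  | a :: r, b :: t => do
    tick
    let q ← dotVec r t
    pure (a * b + q)
  | _, _ => do
    tick
    pure 0

/-- Eliminate the first unknown with the help of the pivot equation, given without its leading
coefficient `1`. -/
def eliminate (p : Option (List Bit × Bit)) :
    List (List Bit × Bit) → RAM n m (List (List Bit × Bit))
  | [] => do
    tick
    pure []
  | e :: es => do
    tick
    let e' ← match p, e with
      | some (r, b), (a :: t, d) =>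
        if a = 1 then do
          let q ← addVec t r
          pure (q, d + b)
        else
          pure (t, d)
      | none, (_ :: t, d) => pure (t, d)
      | _, ([], d) => pure ([], d)
    let q ← eliminate p es
    pure (e' :: q)

/-- Are all right-hand sides zero? -/
def allZero : List (List Bit × Bit) → RAM n m Bool
  | [] => do
    tick
    pure true
  | e :: es => do
    tick
    if e.2 = 0 then allZero es else pure false

/-- Solve a linear system over the field with two elements by Gaussian elimination with
back substitution; the first argument lists the unknowns.  The result is `none` if there is no
solution. -/
def solve : List (Fin n) → List (List Bit × Bit) → RAM n m (Option (List Bit))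
  | [], es => do
    tick
    let ok ← allZero es
    if ok then pure (some []) else pure none
  | _ :: vs, es => do
    tick
    let q ← findPivot es
    let es' ← eliminate q.1 q.2
    let x ← solve vs es'
    match x, q.1 with
    | none, _ => pure none
    | some x, none => pure (some (0 :: x))
    | some x, some (r, b) => do
      let d ← dotVec r x
      pure (some ((b - d) :: x))

/-! ## Rows of the linear system of a cluster -/

/-- Write the bit `b` to the scratch cells of the given variable nodes. -/
def setMarks (b : Bit) : List (Fin n) → RAM n m Unit
  | [] => tick
  | v :: vs => do
    tick
    wr fun s => { s with mark := Function.update s.mark v b }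
    setMarks b vs

/-- Read the scratch cells of the given variable nodes. -/
def readMarks : List (Fin n) → RAM n m (List Bit)
  | [] => do
    tick
    pure []
  | v :: vs => do
    tick
    let b ← rd (·.mark v)
    let r ← readMarks vs
    pure (b :: r)

/-- The indicator vector of the variable nodes in `l`, with respect to the list `vars`. -/
def row (vars l : List (Fin n)) : RAM n m (List Bit) := do
  setMarks 1 l
  let r ← readMarks vars
  setMarks 0 l
  pure r

/-- The neighbours of the check node `c` in a cluster. -/
def neighbours (c : Fin m) : List (Fin m × List (Fin n)) → RAM n m (List (Fin n))
  | [] => do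
    tick
    pure []
  | p :: ps => do
    tick
    if p.1 = c then pure p.2 else neighbours c ps

/-- The row which expresses the value of a variable node, or the contribution to a check node. -/
def nodeRow (cl : Cluster n m) : Node n m → RAM n m (List Bit)
  | .inl v => row cl.vars [v]
  | .inr c => do
    let l ← neighbours c cl.checks
    row cl.vars l

/-! ## First stage: computing solutions, from the leaves to the root -/

/-- The value of the first frozen cluster in the list, if there is one. -/
def firstFrozen : List ℕ → RAM n m (Option Bit)
  | [] => do
    tick
    pure none
  | B :: Bs => do
    tick
    let l ← rd (·.label B)
    match l with
    | some b => pure (some b)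
    | none => firstFrozen Bs

/-- The sum of the values of the clusters in the list if all of them are frozen; otherwise `none`. -/
def sumAllFrozen : List ℕ → RAM n m (Option Bit)
  | [] => do
    tick
    pure (some 0)
  | B :: Bs => do
    tick
    let l ← rd (·.label B)
    match l with
    | none => pure none
    | some b => do
      let q ← sumAllFrozen Bs
      pure (q.map (b + ·))

/-- Compute and store the solutions of the cluster number `B` with parent `p`, subject to the system
`L`, and label the cluster. -/
def computeSolutions (p : Option (Node n m)) (B : ℕ) (cl : Cluster n m)
    (L : List (List Bit × Bit)) : RAM n m Unit :=
  match p with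
  | none => do
    let x ← solve cl.vars L
    wr fun s => { s with sol0 := Function.update s.sol0 B x }
    wr fun s => { s with label := Function.update s.label B (some 0) }
  | some a => do
    let r ← nodeRow cl a
    let x0 ← solve cl.vars ((r, 0) :: L)
    let x1 ← solve cl.vars ((r, 1) :: L)
    wr fun s => { s with sol0 := Function.update s.sol0 B x0 }
    wr fun s => { s with sol1 := Function.update s.sol1 B x1 }
    match x0, x1 with
    | some _, some _ => wr fun s => { s with label := Function.update s.label B none }
    | none, some _ => wr fun s => { s with label := Function.update s.label B (some 1) }
    | _, none => wr fun s => { s with label := Function.update s.label B (some 0) }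

/-- Treat the cluster number `B`, whose parent cut node is `p` (`none` for a root), and all its
descendants.  `s` is the syndrome.  The list `L` collects the equations for `B`: the values of frozen
child variable cut nodes, the syndrome bits of internal checks (these are the checks without child
clusters), and the required contributions to frozen child check cut nodes. -/
def recursiveCompute (s : Fin m → Bit) (p : Option (Node n m)) (B : ℕ) : RAM n m Unit := do
  tick
  let cl ← rd (·.cluster B)
  let L ← cl.vars.foldlM (fun L v => do
    tick
    if p = some (.inl v) then
      pure L
    else do
      let ks ← rd (·.kids (.inl v))
      ks.forM fun B' => recursiveCompute s (some (.inl v)) B'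
      let f ← firstFrozen ks
      match f with
      | some b => do
        let r ← row cl.vars [v]
        pure ((r, b) :: L)
      | none => pure L) []
  let L ← cl.checks.foldlM (fun L q => do
    tick
    if p = some (.inr q.1) then
      pure L
    else do
      let ks ← rd (·.kids (.inr q.1))
      ks.forM fun B' => recursiveCompute s (some (.inr q.1)) B'
      let f ← sumAllFrozen ks
      match f with
      | some b => do
        let r ← row cl.vars q.2
        pure ((r, s q.1 - b) :: L)
      | none => pure L) L
  computeSolutions p B cl L
  partial_fixpoint

/-! ## Second stage: selecting solutions, from the root to the leaves -/

/-- Attach the values of a solution to the variable nodes. -/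
def attach : List (Fin n) → List Bit → RAM n m (List (Fin n × Bit))
  | v :: vs, b :: bs => do
    tick
    let r ← attach vs bs
    pure ((v, b) :: r)
  | _, _ => do
    tick
    pure []

/-- Write the values of a solution to the array `val`. -/
def assign : List (Fin n × Bit) → RAM n m Unit
  | [] => tick
  | q :: qs => do
    tick
    wr fun s => { s with val := Function.update s.val q.1 q.2 }
    assign qs

/-- Sum of the values of the given variable nodes. -/
def sumVal : List (Fin n) → RAM n m Bit
  | [] => do
    tick
    pure 0
  | v :: vs => do
    tick
    let b ← rd (·.val v)
    let q ← sumVal vs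
    pure (b + q)

/-- The contributions to the check nodes of a cluster. -/
def contributions : List (Fin m × List (Fin n)) → RAM n m (List (Fin m × Bit))
  | [] => do
    tick
    pure []
  | q :: qs => do
    tick
    let b ← sumVal q.2
    let r ← contributions qs
    pure ((q.1, b) :: r)

/-- The sum of the values of the frozen clusters in the list. -/
def sumFrozen : List ℕ → RAM n m Bit
  | [] => do
    tick
    pure 0
  | B :: Bs => do
    tick
    let l ← rd (·.label B)
    let q ← sumFrozen Bs
    pure (l.getD 0 + q)

/-- Select a solution of the cluster number `B` with parent `p` (`none` for a root), and of all its
descendants; `b` is the value required at `p`, and it matters only if `B` is free.  Below a check cut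
node the first free cluster has to contribute the missing bit, and the other free clusters have to
contribute `0`. -/
def recursiveSelect (s : Fin m → Bit) (p : Option (Node n m)) (B : ℕ) (b : Bit) :
    RAM n m Unit := do
  tick
  let cl ← rd (·.cluster B)
  let l ← rd (·.label B)
  let x ← if l.getD b = 0 then rd (·.sol0 B) else rd (·.sol1 B)
  let xs ← attach cl.vars (x.getD [])
  wr fun s => { s with chosen := Function.update s.chosen B xs }
  assign xs
  let cs ← contributions cl.checks
  xs.forM fun q => do
    tick
    if p = some (.inl q.1) then
      pure ()
    else do
      let ks ← rd (·.kids (.inl q.1))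
      ks.forM fun B' => recursiveSelect s (some (.inl q.1)) B' q.2
  cs.forM fun q => do
    tick
    if p = some (.inr q.1) then
      pure ()
    else do
      let ks ← rd (·.kids (.inr q.1))
      let f ← sumFrozen ks
      let _ ← ks.foldlM (fun d B' => do
        let l ← rd (·.label B')
        match l with
        | some b' => do
          recursiveSelect s (some (.inr q.1)) B' b'
          pure d
        | none => do
          recursiveSelect s (some (.inr q.1)) B' d
          pure 0) (s q.1 - q.2 - f)
      pure ()
  partial_fixpoint

/-! ## Cluster decomposition post-processing with constrained cluster sizes -/

/-- Number of entries of a list. -/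
def count {α : Type} : List α → RAM n m ℕ
  | [] => do
    tick
    pure 0
  | _ :: l => do
    tick
    let k ← count l
    pure (k + 1)

/-- Is there a cluster, among those with number below the last argument, with more than `C` variable
nodes? -/
def existsLarger (C : ℕ) : ℕ → RAM n m Bool
  | 0 => do
    tick
    pure false
  | B + 1 => do
    tick
    let cl ← rd (·.cluster B)
    let k ← count cl.vars
    if C < k then pure true else existsLarger C B

/-- Copy the values of a selected solution to the output vector. -/
def emit : List (Fin n × Bit) → RAM n m Unit
  | [] => tick
  | q :: qs => do
    tick
    wr fun s => { s with out := Function.update s.out q.1 q.2 }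
    emit qs

/-- Merge the selected solutions of the clusters with number below the argument. -/
def merge : ℕ → RAM n m Unit
  | 0 => tick
  | B + 1 => do
    tick
    let xs ← rd (·.chosen B)
    emit xs
    merge B

end RAM

/-- The result of a decoder: failure, or an estimated error vector. -/
inductive Outcome (n : ℕ) where
  | failure : Outcome n
  | success (x : Fin n → Bit) : Outcome n

/-- Cluster decomposition post-processing with constrained cluster sizes, for the residual Tanner
graph `G`, the residual syndrome `s` and the size constraint `C`. -/
def constrainedClusterDecoder {n m : ℕ} (G : AdjList (Node n m)) (s : Fin m → Bit) (C : ℕ) :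
    RAM n m (Outcome n) := do
  RAM.clusterForest G
  let t ← RAM.rd (·.cnt)
  let large ← RAM.existsLarger C t
  if large then
    pure Outcome.failure
  else do
    let rts ← RAM.rd (·.roots)
    rts.forM fun B => do
      RAM.recursiveCompute s none B
      RAM.recursiveSelect s none B 0
    (List.finRange n).forM fun i => RAM.wr fun s => { s with out := Function.update s.out i 0 }
    RAM.merge t
    let x ← RAM.rd (·.out)
    pure (Outcome.success x)

/-! The running time splits into a depth-first search that is linear in the graph and a second phase
whose cost is summed over the clusters.

For the second phase, the unit of account is `dataSize`: one plus the numbers of variable nodes,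
check nodes and edges of a cluster. A cluster contributes at most one equation per node and one for
its parent, hence at most `dataSize` equations. Elimination makes one pass over the rows for each
unknown, so `R` equations in `a` unknowns cost O(`R * a ^ 2`) for positive `R` and `a`
(`within_solve`). Only the number of unknowns is squared, and the size test bounds it by `C`; checks
and edges enter linearly. A cluster of data size `d` therefore costs O(`d * (C ^ 2 + 1)`).

To add these costs up, each cluster must be visited only once per stage. This is what `IsForest`
provides: a cluster is a child of at most one node, and a node hands its children to at most one
cluster, its owner. Summing the recursive cost inequality over all clusters and cancelling the costs
handed down leaves the own costs (`IsForest.sum_roots_le`). Termination holds because children have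
smaller numbers than the owner.

For the search, `potential` gives an amortized analysis (`run_scan`). Discovering a node releases a
reserve proportional to its degree, which pays for scanning its list; each pushed edge deposits 10
steps, which pay for popping it and for the cluster data it creates. Since `potential` also contains
the cluster data, the same bound shows that their total size is linear in nodes plus edges, hence in
`n`. Biconnectedness and the meaning of low points play no role: the invariant `SearchInv` survives
whichever way the low-point test turns out. -/

namespace RAM

variable {n m : ℕ} {α β : Type}

/-! ### Bounding the time from every state of an invariant -/

/-- From every state which satisfies `I`, the computation `p` halts within `k` steps in a state which
satisfies `I`, with a value which satisfies `P`. -/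
def Within (I : Mem n m → Prop) (k : ℕ) (p : RAM n m α) (P : α → Prop) : Prop :=
  ∀ s, I s → ∃ a s', p s = some (a, s') ∧ I s' ∧ s'.time ≤ s.time + k ∧ P a

namespace Within

variable {I : Mem n m → Prop} {k k₁ k₂ : ℕ} {P : α → Prop} {R : β → Prop}

theorem mono {p : RAM n m α} (h : Within I k₁ p P) (hk : k₁ ≤ k) : Within I k p P := fun s hs => by
  obtain ⟨a, s', h1, h2, h3, h4⟩ := h s hs
  exact ⟨a, s', h1, h2, by omega, h4⟩

theorem imp {p : RAM n m α} {P' : α → Prop} (h : Within I k p P) (hP : ∀ a, P a → P' a) :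
    Within I k p P' := fun s hs => by
  obtain ⟨a, s', h1, h2, h3, h4⟩ := h s hs
  exact ⟨a, s', h1, h2, h3, hP a h4⟩

theorem bind {p : RAM n m α} {f : α → RAM n m β} (h₁ : Within I k₁ p P)
    (h₂ : ∀ a, P a → Within I k₂ (f a) R) : Within I (k₁ + k₂) (p >>= f) R := fun s hs => by
  obtain ⟨a, s', h1, h2, h3, h4⟩ := h₁ s hs
  obtain ⟨b, s'', g1, g2, g3, g4⟩ := h₂ a h4 s' h2
  refine ⟨b, s'', ?_, g2, by omega, g4⟩
  change (p s).bind _ = _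
  rw [h1]
  exact g1

theorem pure {a : α} (h : P a) : Within I 0 (Pure.pure a) P := fun s hs =>
  ⟨a, s, rfl, hs, le_rfl, h⟩

theorem ite {c : Prop} [Decidable c] {p q : RAM n m α} (h₁ : c → Within I k p P)
    (h₂ : ¬c → Within I k q P) : Within I k (if c then p else q) P := by
  split_ifs with hc
  exacts [h₁ hc, h₂ hc]

theorem forM {l : List α} {f : α → RAM n m Unit} {c : α → ℕ}
    (h : ∀ a ∈ l, Within I (c a) (f a) fun _ => True) :
    Within I (l.map c).sum (l.forM f) fun _ => True := by
  induction l with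
  | nil => exact Within.pure trivial
  | cons a l ih =>
    rw [List.map_cons, List.sum_cons]
    exact (h a (by simp)).bind fun _ _ => ih fun b hb => h b (by simp [hb])

/-- The index of `Q` counts the iterations, so that the invariant can bound the length of an
accumulated list. -/
theorem foldlM {l : List α} {f : β → α → RAM n m β} {c : α → ℕ} (Q : ℕ → β → Prop) {i : ℕ} {b : β}
    (hb : Q i b) (h : ∀ a ∈ l, ∀ j b, Q j b → Within I (c a) (f b a) (Q (j + 1))) :
    Within I (l.map c).sum (l.foldlM f b) (Q (i + l.length)) := by
  induction l generalizing i b with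
  | nil => exact Within.pure hb
  | cons a l ih =>
    rw [List.foldlM_cons, List.map_cons, List.sum_cons]
    refine (h a (by simp) i b hb).bind fun b' hb' => ?_
    have := ih hb' fun x hx => h x (by simp [hx])
    rwa [List.length_cons, ← add_assoc, add_right_comm]

end Within

/-- The clusters, the forest and its roots are as given, and no selected solution is longer than the
list of variable nodes of its cluster. -/
def Frame (cl : ℕ → Cluster n m) (kd : Node n m → List ℕ) (rts : List ℕ) (s : Mem n m) : Prop :=
  s.cluster = cl ∧ s.kids = kd ∧ s.roots = rts ∧
    ∀ B, (s.chosen B).length ≤ (cl B).vars.length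

section

variable {cl : ℕ → Cluster n m} {kd : Node n m → List ℕ} {rts : List ℕ} {P : α → Prop} {k : ℕ}

theorem within_tick : Within (Frame cl kd rts) 1 (tick (n := n) (m := m)) fun _ => True :=
  fun _ hs => ⟨_, _, rfl, hs, le_rfl, trivial⟩

theorem within_rd {f : Mem n m → α} (h : ∀ s, Frame cl kd rts s → P (f s)) :
    Within (Frame cl kd rts) 1 (rd f) P :=
  fun s hs => ⟨_, _, rfl, hs, le_rfl, h s hs⟩

theorem within_rd' {f : Mem n m → α} :
    Within (Frame cl kd rts) 1 (rd f) fun _ => True := within_rd fun _ _ => trivial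

theorem within_wr {f : Mem n m → Mem n m} (ht : ∀ s, (f s).time = s.time)
    (h : ∀ s, Frame cl kd rts s → Frame cl kd rts (f s)) :
    Within (Frame cl kd rts) 1 (wr f) fun _ => True :=
  fun s hs => ⟨_, _, rfl, h s hs, by have := ht s; simp only; omega, trivial⟩

theorem Within.tick_bind {f : Unit → RAM n m α} (h : Within (Frame cl kd rts) k (f ()) P) :
    Within (Frame cl kd rts) (k + 1) (tick >>= f) P :=
  (within_tick.bind fun _ _ => h).mono (by omega)

theorem Within.rd_bind {g : Mem n m → β} {f : β → RAM n m α}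
    (h : ∀ b, Within (Frame cl kd rts) k (f b) P) :
    Within (Frame cl kd rts) (k + 1) (rd g >>= f) P :=
  (within_rd'.bind fun b _ => h b).mono (by omega)

theorem Within.wr_bind {g : Mem n m → Mem n m} {f : Unit → RAM n m α}
    (ht : ∀ s, (g s).time = s.time) (hg : ∀ s, Frame cl kd rts s → Frame cl kd rts (g s))
    (h : Within (Frame cl kd rts) k (f ()) P) :
    Within (Frame cl kd rts) (k + 1) (wr g >>= f) P :=
  ((within_wr ht hg).bind fun _ _ => h).mono (by omega)

theorem Within.rd_cluster_bind {B : ℕ} {f : Cluster n m → RAM n m α}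
    (h : Within (Frame cl kd rts) k (f (cl B)) P) :
    Within (Frame cl kd rts) (k + 1) (rd (·.cluster B) >>= f) P :=
  ((within_rd (P := (· = cl B)) fun s hs => by rw [hs.1]).bind fun _ hb => hb ▸ h).mono
    (by omega)

theorem Within.rd_kids_bind {x : Node n m} {f : List ℕ → RAM n m α}
    (h : Within (Frame cl kd rts) k (f (kd x)) P) :
    Within (Frame cl kd rts) (k + 1) (rd (·.kids x) >>= f) P :=
  ((within_rd (P := (· = kd x)) fun s hs => by rw [hs.2.1]).bind fun _ hb => hb ▸ h).mono
    (by omega)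

/-! ### Gaussian elimination -/

theorem within_findPivot {j : ℕ} (es : List (List Bit × Bit)) (hes : ∀ e ∈ es, e.1.length ≤ j + 1) :
    Within (Frame cl kd rts) (es.length + 1) (findPivot es) fun q =>
      q.2.length ≤ es.length ∧ (∀ e ∈ q.2, e.1.length ≤ j + 1) ∧
        ∀ r b, q.1 = some (r, b) → r.length ≤ j := by
  induction es with
  | nil => exact Within.tick_bind (.pure (by simp))
  | cons e es ih =>
    have ih := ih fun e he => hes e (by simp [he])
    have he := hes e (by simp)
    rcases e with ⟨_ | ⟨a, r⟩, b⟩ <;> rw [findPivot] <;> refine Within.tick_bind ?_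
    · refine (ih.bind (k₂ := 0) fun q hq => .pure ?_).mono (by simp)
      simp only [List.length_cons, List.mem_cons, forall_eq_or_imp]
      exact ⟨by omega, ⟨by simp, hq.2.1⟩, hq.2.2⟩
    · refine Within.ite (fun _ => ?_) fun _ => ?_
      · refine (Within.pure ?_).mono (by omega)
        simp only [List.length_cons] at he
        refine ⟨by simp, fun e he => hes e (by simp [he]), fun r' b' h => ?_⟩
        simp only [Option.some.injEq, Prod.mk.injEq] at h
        rw [← h.1]
        omega
      · refine (ih.bind (k₂ := 0) fun q hq => .pure ?_).mono (by simp)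
        simp only [List.length_cons, List.mem_cons, forall_eq_or_imp]
        exact ⟨by omega, ⟨by simpa using he, hq.2.1⟩, hq.2.2⟩

theorem within_addVec (x y : List Bit) :
    Within (Frame cl kd rts) (x.length + 1) (addVec x y) fun z => z.length ≤ x.length := by
  induction x generalizing y with
  | nil => rw [addVec.eq_2 _ _ (by simp)]; exact Within.tick_bind (.pure (by simp))
  | cons a x ih =>
    rcases y with _ | ⟨b, y⟩
    · rw [addVec.eq_2 _ _ (by simp)]
      exact Within.mono (k₁ := 1) (Within.tick_bind (.pure (by simp))) (by simp)
    · rw [addVec]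
      exact Within.tick_bind ((ih y).bind (k₂ := 0) fun z hz => .pure (by simpa using hz))

theorem within_dotVec (x y : List Bit) :
    Within (Frame cl kd rts) (x.length + 1) (dotVec x y) fun _ => True := by
  induction x generalizing y with
  | nil => rw [dotVec.eq_2 _ _ (by simp)]; exact Within.tick_bind (.pure (by simp))
  | cons a x ih =>
    rcases y with _ | ⟨b, y⟩
    · rw [dotVec.eq_2 _ _ (by simp)]
      exact Within.mono (k₁ := 1) (Within.tick_bind (.pure (by simp))) (by simp)
    · rw [dotVec]
      exact Within.tick_bind ((ih y).bind (k₂ := 0) fun z hz => .pure (by simp))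

theorem within_eliminate {j : ℕ} (p : Option (List Bit × Bit)) (es : List (List Bit × Bit))
    (hes : ∀ e ∈ es, e.1.length ≤ j + 1) :
    Within (Frame cl kd rts) (es.length * (j + 2) + 1) (eliminate p es) fun q =>
      q.length = es.length ∧ ∀ e ∈ q, e.1.length ≤ j := by
  induction es with
  | nil => exact Within.mono (k₁ := 1) (Within.tick_bind (.pure (by simp))) (by simp)
  | cons e es ih =>
    have ih := ih fun e he => hes e (by simp [he])
    have he := hes e (by simp)
    -- What remains to be done once the reduced row `e'` is known is the same in all cases.
    have key : ∀ e' : List Bit × Bit, e'.1.length ≤ j → Within (Frame cl kd rts)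
        (es.length * (j + 2) + 1) (do let q ← eliminate p es; pure (e' :: q)) fun q =>
          q.length = (e :: es).length ∧ ∀ e ∈ q, e.1.length ≤ j := fun e' he' =>
      ih.bind (k₂ := 0) fun q hq => .pure <| by
        simp only [List.length_cons, List.mem_cons, forall_eq_or_imp]
        exact ⟨by omega, he', hq.2⟩
    rw [eliminate, List.length_cons]
    refine (Within.tick_bind (k := (j + 1) + (es.length * (j + 2) + 1)) ?_).mono
      (by ring_nf; omega)
    rcases p with _ | ⟨r, b⟩ <;> rcases e with ⟨_ | ⟨a, t⟩, d⟩
    · exact (key ([], d) (by simp)).mono (by omega)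
    · exact (key (t, d) (by simpa using he)).mono (by omega)
    · exact (key ([], d) (by simp)).mono (by omega)
    · have ht : t.length ≤ j := by simpa using he
      refine Within.ite (fun _ => ?_) fun _ => (key (t, d) ht).mono (by omega)
      exact ((within_addVec t r).mono (by omega)).bind fun q hq => key (q, d + b) (hq.trans ht)

theorem within_allZero (es : List (List Bit × Bit)) :
    Within (Frame cl kd rts) (es.length + 1) (allZero es) fun _ => True := by
  induction es with
  | nil => exact Within.tick_bind (.pure (by simp))
  | cons e es ih =>
    exact Within.tick_bind (.ite (fun _ => ih) fun _ => (Within.pure trivial).mono (by omega))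

/-- `R` is kept fixed in the induction because elimination never increases the number of equations,
while each step shortens the rows by one. -/
theorem within_solve (vs : List (Fin n)) (es : List (List Bit × Bit)) {R : ℕ} (hR : es.length ≤ R)
    (hes : ∀ e ∈ es, e.1.length ≤ vs.length) :
    Within (Frame cl kd rts) ((R + 1) * (vs.length + 2) ^ 2) (solve vs es) fun _ => True := by
  induction vs generalizing es with
  | nil =>
    rw [solve]
    refine (Within.tick_bind ((within_allZero es).bind (k₂ := 0) fun _ _ =>
      .ite (fun _ => .pure trivial) fun _ => .pure trivial)).mono ?_
    simp only [List.length_nil]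
    omega
  | cons v vs ih =>
    rw [solve]
    -- The squares of `vs.length + 3` and `vs.length + 2` differ by `2 * vs.length + 5`; times `R +
    -- 1`, this covers the pivot search, the elimination pass and the scalar product for one
    -- unknown.
    have arith : (((es.length + 1) + ((R * (vs.length + 2) + 1) + ((R + 1) * (vs.length + 2) ^ 2 +
        (vs.length + 1)))) + 1) ≤ (R + 1) * ((v :: vs).length + 2) ^ 2 := by
      rw [List.length_cons]
      nlinarith
    refine (Within.tick_bind ((within_findPivot es hes).bind fun q hq =>
      ((within_eliminate q.1 q.2 hq.2.1).mono
        (Nat.add_le_add_right (Nat.mul_le_mul_right _ (hq.1.trans hR)) 1)).bind fun es' hes' =>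
        (ih es' (by omega) hes'.2).bind fun x _ => ?_)).mono arith
    rcases q with ⟨_ | ⟨r, b⟩, q⟩ <;> rcases x with _ | x
    · exact (Within.pure trivial).mono (by omega)
    · exact (Within.pure trivial).mono (by omega)
    · exact (Within.pure trivial).mono (by omega)
    · refine ((within_dotVec r x).bind (k₂ := 0) fun d _ => .pure trivial).mono ?_
      have := hq.2.2 r b rfl
      omega

/-! ### Rows -/

theorem within_setMarks (b : Bit) (l : List (Fin n)) :
    Within (Frame cl kd rts) (2 * l.length + 1) (setMarks (m := m) b l) fun _ => True := by
  induction l with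
  | nil => exact within_tick
  | cons v l ih =>
    exact (Within.tick_bind (.wr_bind (by intro; rfl) (by intro _ h; exact h) ih)).mono
      (by simp only [List.length_cons]; omega)

theorem within_readMarks (l : List (Fin n)) :
    Within (Frame cl kd rts) (2 * l.length + 1) (readMarks (m := m) l) fun r =>
      r.length ≤ l.length := by
  induction l with
  | nil => exact Within.tick_bind (.pure (by simp))
  | cons v l ih =>
    exact (Within.tick_bind (.rd_bind fun b => ih.bind (k₂ := 0) fun r hr =>
      .pure (by simpa using hr))).mono (by simp only [List.length_cons]; omega)

/-- The scratch cells make the cost additive in the two lengths, where testing membership entry by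
entry would give a product. Marks are set and erased along `l`, which accounts for the factor 4. -/
theorem within_row (vars l : List (Fin n)) :
    Within (Frame cl kd rts) (2 * vars.length + 4 * l.length + 3) (row (m := m) vars l) fun r =>
      r.length ≤ vars.length := by
  rw [row]
  refine ((within_setMarks 1 l).bind fun _ _ => (within_readMarks vars).bind fun _ hr =>
    (within_setMarks 0 l).bind (k₂ := 0) fun _ _ => .pure hr).mono ?_
  omega

/-- The number of edges of a cluster, given by the neighbour lists of its check nodes. -/
def edgeCount (l : List (Fin m × List (Fin n))) : ℕ := (l.map fun q => q.2.length).sum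

theorem within_neighbours (c : Fin m) (l : List (Fin m × List (Fin n))) :
    Within (Frame cl kd rts) (l.length + 1) (neighbours c l) fun r => r.length ≤ edgeCount l := by
  induction l with
  | nil => exact Within.tick_bind (.pure (by simp))
  | cons q l ih =>
    refine Within.tick_bind (.ite (fun _ => (Within.pure ?_).mono (by omega)) fun _ =>
      ih.imp fun r hr => ?_)
    · simp [edgeCount]
    · simp only [edgeCount, List.map_cons, List.sum_cons] at hr ⊢
      omega

/-- The size of the data of a cluster. -/
def dataSize (c : Cluster n m) : ℕ := 1 + c.vars.length + c.checks.length + edgeCount c.checks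

theorem within_nodeRow (c : Cluster n m) (a : Node n m) :
    Within (Frame cl kd rts) (11 * dataSize c) (nodeRow c a) fun r =>
      r.length ≤ c.vars.length := by
  rcases a with v | a
  · refine (within_row c.vars [v]).mono ?_
    simp only [List.length_singleton, dataSize]
    omega
  · refine ((within_neighbours a c.checks).bind (k₂ := 7 * dataSize c) fun l hl =>
      (within_row c.vars l).mono ?_).mono ?_ <;> simp only [dataSize] <;> omega

/-! ### First stage -/

theorem within_firstFrozen (l : List ℕ) :
    Within (Frame cl kd rts) (2 * l.length + 1) (firstFrozen l) fun _ => True := by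
  induction l with
  | nil => exact Within.tick_bind (.pure (by simp))
  | cons B l ih =>
    refine (Within.tick_bind (.rd_bind fun b => ?_)).mono
      (k₁ := 2 * l.length + 1 + 1 + 1) (by simp only [List.length_cons]; omega)
    rcases b with _ | b
    exacts [ih, (Within.pure trivial).mono (by omega)]

theorem within_sumAllFrozen (l : List ℕ) :
    Within (Frame cl kd rts) (2 * l.length + 1) (sumAllFrozen l) fun _ => True := by
  induction l with
  | nil => exact Within.tick_bind (.pure (by simp))
  | cons B l ih =>
    refine (Within.tick_bind (.rd_bind fun b => ?_)).mono
      (k₁ := 2 * l.length + 1 + 1 + 1) (by simp only [List.length_cons]; omega)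
    rcases b with _ | b
    exacts [(Within.pure trivial).mono (by omega), ih.bind (k₂ := 0) fun _ _ => .pure trivial]

theorem within_computeSolutions (p : Option (Node n m)) (B : ℕ) (c : Cluster n m)
    (L : List (List Bit × Bit)) (hL : L.length ≤ c.vars.length + c.checks.length)
    (hr : ∀ e ∈ L, e.1.length ≤ c.vars.length) :
    Within (Frame cl kd rts) (11 * dataSize c + 4 * (dataSize c * (c.vars.length + 2) ^ 2) + 3)
      (computeSolutions p B c L) fun _ => True := by
  have hS : 1 ≤ dataSize c := by simp only [dataSize]; omega
  -- The summand 1 in `dataSize` leaves room for the equation at the parent.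
  have hL' : L.length + 1 ≤ dataSize c := by simp only [dataSize]; omega
  have hle : (dataSize c + 1) * (c.vars.length + 2) ^ 2 ≤
      2 * (dataSize c * (c.vars.length + 2) ^ 2) := by
    rw [← mul_assoc]
    exact Nat.mul_le_mul_right _ (by omega)
  rcases p with _ | a
  · refine ((within_solve c.vars L (R := dataSize c) (by omega) hr).bind fun x _ =>
      Within.wr_bind (by intro; rfl) (by intro _ h; exact h)
        (within_wr (by intro; rfl) (by intro _ h; exact h))).mono ?_
    omega
  · refine ((within_nodeRow c a).bind fun r hr' =>
      (within_solve c.vars ((r, 0) :: L) (R := dataSize c) (by simpa using hL') ?_).bind fun x0 _ =>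
      (within_solve c.vars ((r, 1) :: L) (R := dataSize c) (by simpa using hL') ?_).bind fun x1 _ =>
      Within.wr_bind (by intro; rfl) (by intro _ h; exact h)
        (Within.wr_bind (by intro; rfl) (by intro _ h; exact h) (k := 1) ?_)).mono ?_
    · exact List.forall_mem_cons.2 ⟨hr', hr⟩
    · exact List.forall_mem_cons.2 ⟨hr', hr⟩
    · rcases x0 with _ | x0 <;> rcases x1 with _ | x1 <;>
        exact within_wr (by intro; rfl) (by intro _ h; exact h)
    · omega

end

end RAM

namespace RAM

variable {n m : ℕ} {α β : Type}

/-- The nodes of a cluster. -/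
def clusterNodes (c : Cluster n m) : List (Node n m) :=
  c.vars.map Sum.inl ++ c.checks.map fun q => Sum.inr q.1

/-- The cost of the child clusters below the node `x` of a cluster with parent `p`, if the cluster
number `B` costs `f B`. -/
def childCost (kd : Node n m → List ℕ) (f : ℕ → ℕ) (p : Option (Node n m)) (x : Node n m) : ℕ :=
  if p = some x then 0 else ((kd x).map fun B => f B + 3).sum

/-- The surcharge of 3 per child pays for reading its label: two steps in the scan of all labels,
and one more in the selection loop below a check node. -/
theorem sum_kids_add (l : List ℕ) (f : ℕ → ℕ) :
    (l.map fun B => f B + 3).sum = (l.map f).sum + 3 * l.length := by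
  simp [List.sum_map_add, mul_comm]

section

variable {cl : ℕ → Cluster n m} {kd : Node n m → List ℕ} {rts : List ℕ} {P : α → Prop} {k : ℕ}

theorem sum_map_childCost (c : Cluster n m) (f : ℕ → ℕ) (p : Option (Node n m)) :
    ((clusterNodes c).map (childCost kd f p)).sum =
      (c.vars.map fun v => childCost kd f p (.inl v)).sum +
        (c.checks.map fun q => childCost kd f p (.inr q.1)).sum := by
  simp [clusterNodes, Function.comp_def]

/-- One level of the recursion: the costs of the children are a hypothesis, so that the global
summation can be done separately and for both stages at once. -/
theorem within_recursiveCompute (s : Fin m → Bit) (p : Option (Node n m)) (B : ℕ) (f : ℕ → ℕ)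
    (h : ∀ x ∈ clusterNodes (cl B), p ≠ some x → ∀ B' ∈ kd x,
      Within (Frame cl kd rts) (f B') (recursiveCompute s (some x) B') fun _ => True) :
    Within (Frame cl kd rts)
      (100 * (dataSize (cl B) * ((cl B).vars.length + 2) ^ 2) +
        ((clusterNodes (cl B)).map (childCost kd f p)).sum)
      (recursiveCompute s p B) fun _ => True := by
  set c := cl B with hc
  have hv : ∀ v ∈ c.vars, Sum.inl v ∈ clusterNodes c := fun v hv => by simp [clusterNodes, hv]
  have hk : ∀ q ∈ c.checks, Sum.inr q.1 ∈ clusterNodes c := fun q hq => by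
    simp only [clusterNodes, List.mem_append, List.mem_map]
    exact Or.inr ⟨q, hq, rfl⟩
  rw [recursiveCompute]
  -- At most one equation arises per treated node; the counter runs on from the loop over variable
  -- nodes into the loop over check nodes.
  let Q : ℕ → List (List Bit × Bit) → Prop := fun i L =>
    L.length ≤ i ∧ ∀ e ∈ L, e.1.length ≤ c.vars.length
  refine Within.mono (Within.tick_bind (.rd_cluster_bind (.bind
    (.foldlM Q (i := 0) (c := fun v => 2 * c.vars.length + 10 + childCost kd f p (.inl v))
      ⟨le_rfl, by simp⟩ fun v hv' j L hL => ?_) fun L hL =>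
    .bind (.foldlM Q (c := fun q : Fin m × List (Fin n) => 2 * c.vars.length + 6 + 4 * q.2.length +
      childCost kd f p (.inr q.1)) hL fun q hq j L hL => ?_) fun L hL =>
    within_computeSolutions p B c L (by simpa using hL.1) hL.2))) ?_
  · refine (Within.tick_bind (k := 2 * c.vars.length + 9 + childCost kd f p (.inl v))
      (.ite (fun _ => (Within.pure ⟨hL.1.trans (by omega), hL.2⟩).mono (by omega))
        fun hp => ?_)).mono (by omega)
    rw [childCost, if_neg hp, sum_kids_add]
    refine (Within.rd_kids_bind ((Within.forM fun B' hB' => h _ (hv v hv') hp B' hB').bind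
      fun _ _ => (within_firstFrozen _).bind (k₂ := 2 * c.vars.length + 7)
      fun b _ => ?_)).mono ?_
    · rcases b with _ | b
      · exact (Within.pure ⟨hL.1.trans (by omega), hL.2⟩).mono (by omega)
      · refine (within_row c.vars [v]).bind (k₂ := 0) fun r hr => .pure ⟨?_, ?_⟩
        · simpa using hL.1
        · exact List.forall_mem_cons.2 ⟨hr, hL.2⟩
    · omega
  · refine (Within.tick_bind (k := 2 * c.vars.length + 5 + 4 * q.2.length +
      childCost kd f p (.inr q.1))
      (.ite (fun _ => (Within.pure ⟨hL.1.trans (by omega), hL.2⟩).mono (by omega))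
        fun hp => ?_)).mono (by omega)
    rw [childCost, if_neg hp, sum_kids_add]
    refine (Within.rd_kids_bind ((Within.forM fun B' hB' => h _ (hk q hq) hp B' hB').bind
      fun _ _ => (within_sumAllFrozen _).bind (k₂ := 2 * c.vars.length + 3 + 4 * q.2.length)
      fun b _ => ?_)).mono ?_
    · rcases b with _ | b
      · exact (Within.pure ⟨hL.1.trans (by omega), hL.2⟩).mono (by omega)
      · refine ((within_row c.vars q.2).bind (k₂ := 0) fun r hr => .pure ⟨?_, ?_⟩).mono (by omega)
        · simpa using hL.1
        · exact List.forall_mem_cons.2 ⟨hr, hL.2⟩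
    · omega
  · rw [sum_map_childCost]
    simp only [List.sum_map_add, List.map_const', List.sum_replicate, smul_eq_mul,
      List.sum_map_mul_left]
    have hS : dataSize c = 1 + c.vars.length + c.checks.length +
      (c.checks.map fun q => q.2.length).sum := rfl
    generalize (c.checks.map fun q => q.2.length).sum = e at *
    generalize (c.vars.map fun v => childCost kd f p (.inl v)).sum = x
    generalize (c.checks.map fun q => childCost kd f p (.inr q.1)).sum = y
    generalize c.vars.length = a at *
    generalize c.checks.length = b at *
    rw [hS]
    nlinarith [Nat.zero_le (a * b), Nat.zero_le (a * e), Nat.zero_le (a * a * b),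
      Nat.zero_le (a * a * e), Nat.zero_le (a * a * a)]

/-! ### Second stage -/

/-- Only a prefix is claimed, because a missing solution is replaced by the empty list. A prefix
suffices: it visits no further child clusters and is no longer than `vs`. -/
theorem within_attach (vs : List (Fin n)) (bs : List Bit) :
    Within (Frame cl kd rts) (vs.length + 1) (attach (m := m) vs bs) fun xs =>
      xs.map Prod.fst <+: vs := by
  induction vs generalizing bs with
  | nil => rw [attach.eq_2 _ _ (by simp)]; exact Within.tick_bind (.pure (by simp))
  | cons v vs ih =>
    rcases bs with _ | ⟨b, bs⟩
    · rw [attach.eq_2 _ _ (by simp)]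
      exact Within.mono (k₁ := 1) (Within.tick_bind (.pure (by simp))) (by simp)
    · rw [attach]
      exact Within.tick_bind ((ih bs).bind (k₂ := 0) fun r hr => .pure (by simpa using hr))

theorem within_assign (l : List (Fin n × Bit)) :
    Within (Frame cl kd rts) (2 * l.length + 1) (assign (m := m) l) fun _ => True := by
  induction l with
  | nil => exact within_tick
  | cons v l ih =>
    refine (Within.tick_bind (.wr_bind (by intro; rfl) (by intro _ h; exact h) ih)).mono ?_
    simp only [List.length_cons]
    omega

theorem within_sumVal (l : List (Fin n)) :
    Within (Frame cl kd rts) (2 * l.length + 1) (sumVal (m := m) l) fun _ => True := by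
  induction l with
  | nil => exact Within.tick_bind (.pure trivial)
  | cons v l ih =>
    refine (Within.tick_bind (.rd_bind fun _ => ih.bind (k₂ := 0) fun _ _ => .pure trivial)).mono ?_
    simp only [List.length_cons]
    omega

theorem within_contributions (l : List (Fin m × List (Fin n))) :
    Within (Frame cl kd rts) (2 * l.length + 2 * edgeCount l + 1) (contributions l) fun r =>
      r.map Prod.fst = l.map Prod.fst := by
  induction l with
  | nil => exact Within.tick_bind (.pure (by simp))
  | cons q l ih =>
    refine (Within.tick_bind ((within_sumVal q.2).bind fun _ _ => ih.bind (k₂ := 0) fun r hr =>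
      .pure ?_)).mono ?_
    · simpa using hr
    · simp only [List.length_cons, edgeCount, List.map_cons, List.sum_cons]
      omega

theorem within_sumFrozen (l : List ℕ) :
    Within (Frame cl kd rts) (2 * l.length + 1) (sumFrozen l) fun _ => True := by
  induction l with
  | nil => exact Within.tick_bind (.pure trivial)
  | cons v l ih =>
    refine (Within.tick_bind (.rd_bind fun _ => ih.bind (k₂ := 0) fun _ _ => .pure trivial)).mono ?_
    simp only [List.length_cons]
    omega

theorem within_recursiveSelect (s : Fin m → Bit) (p : Option (Node n m)) (B : ℕ) (b : Bit)
    (f : ℕ → ℕ)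
    (h : ∀ x ∈ clusterNodes (cl B), p ≠ some x → ∀ B' ∈ kd x, ∀ b,
      Within (Frame cl kd rts) (f B') (recursiveSelect s (some x) B' b) fun _ => True) :
    Within (Frame cl kd rts)
      (10 * dataSize (cl B) + ((clusterNodes (cl B)).map (childCost kd f p)).sum)
      (recursiveSelect s p B b) fun _ => True := by
  set c := cl B with hc
  have hv : ∀ v ∈ c.vars, Sum.inl v ∈ clusterNodes c := fun v hv => by simp [clusterNodes, hv]
  have hk : ∀ a ∈ c.checks.map Prod.fst, Sum.inr a ∈ clusterNodes c := fun a ha => by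
    simpa [clusterNodes] using ha
  rw [sum_map_childCost]
  set x := (c.vars.map fun v => childCost kd f p (.inl v)).sum
  set y := (c.checks.map fun q => childCost kd f p (.inr q.1)).sum with hy
  have hS : dataSize c = 1 + c.vars.length + c.checks.length + edgeCount c.checks := rfl
  -- The part after reading the stored solution is treated for an arbitrary `sol`, and so serves
  -- both `sol0` and `sol1`.
  have main : ∀ sol : Option (List Bit), Within (Frame cl kd rts)
      (8 * dataSize c - 2 + (x + y)) (do
        let xs ← attach c.vars (sol.getD [])
        wr fun s => { s with chosen := Function.update s.chosen B xs }
        assign xs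
        let cs ← contributions c.checks
        xs.forM fun q => do
          tick
          if p = some (.inl q.1) then
            pure ()
          else do
            let ks ← rd (·.kids (.inl q.1))
            ks.forM fun B' => recursiveSelect s (some (.inl q.1)) B' q.2
        cs.forM fun q => do
          tick
          if p = some (.inr q.1) then
            pure ()
          else do
            let ks ← rd (·.kids (.inr q.1))
            let f ← sumFrozen ks
            let _ ← ks.foldlM (fun d B' => do
              let l ← rd (·.label B')
              match l with
              | some b' => do
                recursiveSelect s (some (.inr q.1)) B' b'
                pure d
              | none => do
                recursiveSelect s (some (.inr q.1)) B' d
                pure 0) (s q.1 - q.2 - f)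
            pure ()) fun _ => True := fun sol => by
    refine ((within_attach c.vars (sol.getD [])).bind fun xs hxs =>
      .wr_bind (by intro; rfl) ?_ (((within_assign xs).mono (k := 2 * c.vars.length + 1) ?_).bind
        fun _ _ => (within_contributions c.checks).bind fun cs hcs =>
        .bind (k₁ := 2 * c.vars.length + x) (P := fun _ => True) ?_ fun _ _ =>
        (?_ : Within _ (3 * c.checks.length + y) _ _))).mono ?_
    -- Writing `chosen` affects the length bound in `Frame`; the prefix property restores it.
    · rintro s ⟨h1, h2, h3, h4⟩
      refine ⟨h1, h2, h3, fun B' => ?_⟩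
      by_cases hB : B' = B
      · subst hB
        simpa using hxs.length_le
      · simpa [hB] using h4 B'
    · have := hxs.length_le
      rw [List.length_map] at this
      omega
    · refine (Within.forM (c := fun q => 2 + childCost kd f p (.inl q.1)) fun q hq => ?_).mono ?_
      · refine (Within.tick_bind (k := 1 + childCost kd f p (.inl q.1))
          (.ite (fun _ => (Within.pure trivial).mono (by omega)) fun hp => ?_)).mono (by omega)
        rw [childCost, if_neg hp, sum_kids_add]
        refine (Within.rd_kids_bind (Within.forM fun B' hB' =>
          h _ (hv q.1 (hxs.subset (List.mem_map_of_mem hq))) hp B' hB' q.2)).mono ?_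
        omega
      · have h1 : (xs.map fun q => childCost kd f p (.inl q.1)).sum ≤ x := by
          have := (hxs.sublist.map fun v => childCost kd f p (.inl v)).sum_le_sum (by simp)
          rwa [List.map_map] at this
        have := hxs.length_le
        rw [List.length_map] at this
        simp only [List.sum_map_add, List.map_const', List.sum_replicate, smul_eq_mul]
        omega
    · refine (Within.forM (c := fun q => 3 + childCost kd f p (.inr q.1)) fun q hq => ?_).mono ?_
      · refine (Within.tick_bind (k := 2 + childCost kd f p (.inr q.1))
          (.ite (fun _ => (Within.pure trivial).mono (by omega)) fun hp => ?_)).mono (by omega)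
        rw [childCost, if_neg hp, sum_kids_add]
        have hq' : Sum.inr q.1 ∈ clusterNodes c := hk q.1 (hcs ▸ List.mem_map_of_mem hq)
        refine (Within.rd_kids_bind ((within_sumFrozen _).bind fun g _ =>
          .bind (k₂ := 0) (.foldlM (fun _ _ => True) (i := 0) (c := fun B' => f B' + 1)
            trivial fun B' hB' j d _ => (?_ : Within _ (f B' + 1) _ _)) fun _ _ =>
              .pure trivial)).mono ?_
        · refine Within.rd_bind fun l => ?_
          rcases l with _ | l
          · exact (h _ hq' hp B' hB' d).bind (k₂ := 0) fun _ _ => .pure trivial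
          · exact (h _ hq' hp B' hB' l).bind (k₂ := 0) fun _ _ => .pure trivial
        · simp only [List.sum_map_add, List.map_const', List.sum_replicate, smul_eq_mul]
          omega
      · have h1 : (cs.map fun q => childCost kd f p (.inr q.1)).sum = y := by
          have := congrArg (fun l => (l.map fun a => childCost kd f p (.inr a)).sum) hcs
          simpa [List.map_map, Function.comp_def] using this
        have := congrArg List.length hcs
        simp only [List.length_map] at this
        simp only [List.sum_map_add, List.map_const', List.sum_replicate, smul_eq_mul]
        omega
    · omega
  rw [recursiveSelect]
  refine (Within.tick_bind (.rd_cluster_bind (.rd_bind fun l => .ite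
    (k := 8 * dataSize c - 2 + (x + y) + 1) (fun _ => ?_) fun _ => ?_))).mono ?_
  · exact .rd_bind main
  · exact .rd_bind main
  · omega

/-! ### Testing sizes and merging -/

theorem within_count (l : List α) :
    Within (Frame cl kd rts) (l.length + 1) (count l) fun k => k = l.length := by
  induction l with
  | nil => exact Within.tick_bind (.pure rfl)
  | cons a l ih => exact Within.tick_bind (ih.bind (k₂ := 0) fun k hk => .pure (by simpa using hk))

/-- The negative answer is what makes the bound `C` on the number of unknowns available in the
elimination. -/
theorem within_existsLarger (C t : ℕ) :
    Within (Frame cl kd rts) (4 * (∑ B ∈ Finset.range t, dataSize (cl B)) + 1) (existsLarger C t)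
      fun b => b = false → ∀ B < t, (cl B).vars.length ≤ C := by
  induction t with
  | zero => exact Within.tick_bind (.pure (by simp))
  | succ t ih =>
    rw [Finset.sum_range_succ]
    refine (Within.tick_bind (.rd_cluster_bind ((within_count _).bind fun k hk => .ite
      (k := 4 * (∑ B ∈ Finset.range t, dataSize (cl B)) + 1)
      (fun _ => (Within.pure ?_).mono (by omega)) fun hC => ih.imp fun b hb h B hB => ?_))).mono ?_
    · simp
    · rcases Nat.lt_succ_iff_lt_or_eq.1 hB with h' | rfl
      · exact hb h B h'
      · omega
    · simp only [dataSize]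
      omega

theorem within_emit (l : List (Fin n × Bit)) :
    Within (Frame cl kd rts) (2 * l.length + 1) (emit (m := m) l) fun _ => True := by
  induction l with
  | nil => exact within_tick
  | cons v l ih =>
    refine (Within.tick_bind (.wr_bind (by intro; rfl) (by intro _ h; exact h) ih)).mono ?_
    simp only [List.length_cons]
    omega

theorem within_merge (t : ℕ) :
    Within (Frame cl kd rts) (3 * (∑ B ∈ Finset.range t, dataSize (cl B)) + 1)
      (merge (n := n) (m := m) t) fun _ => True := by
  induction t with
  | zero => exact within_tick
  | succ t ih =>
    rw [Finset.sum_range_succ]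
    refine (Within.tick_bind ((within_rd (P := fun xs => xs.length ≤ (cl t).vars.length)
      fun s hs => hs.2.2.2 t).bind fun xs hxs =>
      ((within_emit xs).mono (k := 2 * (cl t).vars.length + 1) (by omega)).bind fun _ _ => ih)).mono ?_
    simp only [dataSize]
    omega

end

end RAM

/-! ### Summation of costs over the cluster forest -/

namespace RAM

variable {n m : ℕ}

/-- The clusters with number below `cnt` form a forest: `kd x` lists the child clusters of the node
`x`, every cluster is a child of at most one node, every node lies in at most one cluster of which it
is not the parent, and clusters have larger numbers than their descendants. -/
structure IsForest (cl : ℕ → Cluster n m) (kd : Node n m → List ℕ) (rts : List ℕ) (cnt : ℕ) :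
    Prop where
  kids_pairwise : ∀ x, (kd x).Pairwise (· > ·)
  kids_lt : ∀ x, ∀ B ∈ kd x, B < cnt
  kids_inj : ∀ x y B, B ∈ kd x → B ∈ kd y → x = y
  roots_nodup : rts.Nodup
  roots_lt : ∀ B ∈ rts, B < cnt
  roots_not_mem : ∀ B ∈ rts, ∀ x, B ∉ kd x
  nodes_nodup : ∀ B < cnt, (clusterNodes (cl B)).Nodup
  owner_unique : ∀ x, ∀ B < cnt, ∀ B' < cnt, x ∈ clusterNodes (cl B) → B ∉ kd x →
    x ∈ clusterNodes (cl B') → B' ∉ kd x → B = B'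
  kids_lt_owner : ∀ x, ∀ B < cnt, x ∈ clusterNodes (cl B) → B ∉ kd x → ∀ B' ∈ kd x, B' < B

theorem sum_map_eq_sum_ite {α : Type} {l : List α} [DecidablePred (· ∈ l)] (hl : l.Nodup) {S : Finset α}
    (hS : ∀ a ∈ l, a ∈ S) (V : α → ℕ) :
    (l.map V).sum = ∑ a ∈ S, if a ∈ l then V a else 0 := by
  classical
  rw [← List.sum_toFinset V hl, ← Finset.sum_filter]
  congr 1
  ext a
  simpa using hS a

theorem sum_ite_le_of_unique {α : Type} {S : Finset α} {p : α → Prop} [DecidablePred p]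
    (hp : ∀ a ∈ S, ∀ b ∈ S, p a → p b → a = b) (c : ℕ) : (∑ a ∈ S, if p a then c else 0) ≤ c := by
  rw [← Finset.sum_filter, Finset.sum_const, smul_eq_mul]
  have : (S.filter p).card ≤ 1 := Finset.card_le_one.2 fun a ha b hb => by
    rw [Finset.mem_filter] at ha hb
    exact hp a ha.1 b hb.1 ha.2 hb.2
  nlinarith

namespace IsForest

variable {cl : ℕ → Cluster n m} {kd : Node n m → List ℕ} {rts : List ℕ} {cnt : ℕ}

/-- In a forest, the costs of all clusters bound the total costs accumulated at the roots. -/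
theorem sum_roots_le (h : IsForest cl kd rts cnt) (cost V : ℕ → ℕ)
    (hV : ∀ B < cnt, V B ≤ cost B + ((clusterNodes (cl B)).map fun x =>
      if B ∈ kd x then 0 else ((kd x).map V).sum).sum) :
    (rts.map V).sum ≤ ∑ B ∈ Finset.range cnt, cost B := by
  classical
  -- A node hands the costs of its children to its owner only, and there is at most one owner.
  have h1 : ∑ B ∈ Finset.range cnt, ((clusterNodes (cl B)).map fun x =>
      if B ∈ kd x then 0 else ((kd x).map V).sum).sum ≤ ∑ x, ((kd x).map V).sum := by
    calc _ = ∑ B ∈ Finset.range cnt, ∑ x : Node n m,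
          if x ∈ clusterNodes (cl B) ∧ B ∉ kd x then ((kd x).map V).sum else 0 := by
          refine Finset.sum_congr rfl fun B hB => ?_
          rw [sum_map_eq_sum_ite (h.nodes_nodup B (Finset.mem_range.1 hB)) (S := Finset.univ)
            (by simp)]
          refine Finset.sum_congr rfl fun x _ => ?_
          by_cases h1 : x ∈ clusterNodes (cl B) <;> by_cases h2 : B ∈ kd x <;> simp [h1, h2]
      _ ≤ _ := by
          rw [Finset.sum_comm]
          refine Finset.sum_le_sum fun x _ => sum_ite_le_of_unique (fun B hB B' hB' hx hx' => ?_) _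
          exact h.owner_unique x B (Finset.mem_range.1 hB) B' (Finset.mem_range.1 hB') hx.1 hx.2
            hx'.1 hx'.2
  -- A cluster is counted at most once on the left: either as a root or as a child of a single node.
  have h2 : (rts.map V).sum + ∑ x, ((kd x).map V).sum ≤ ∑ B ∈ Finset.range cnt, V B := by
    rw [sum_map_eq_sum_ite h.roots_nodup (S := Finset.range cnt)
      (fun B hB => Finset.mem_range.2 (h.roots_lt B hB))]
    have : ∀ x, ((kd x).map V).sum = ∑ B ∈ Finset.range cnt, if B ∈ kd x then V B else 0 :=
      fun x => sum_map_eq_sum_ite ((h.kids_pairwise x).imp fun hab => ne_of_gt hab)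
        (fun B hB => Finset.mem_range.2 (h.kids_lt x B hB)) V
    simp only [this]
    rw [Finset.sum_comm, ← Finset.sum_add_distrib]
    refine Finset.sum_le_sum fun B _ => ?_
    by_cases hB : B ∈ rts
    · simp [hB, h.roots_not_mem B hB]
    · simpa [hB] using sum_ite_le_of_unique (S := Finset.univ) (p := fun x => B ∈ kd x)
        (fun x _ y _ hx hy => h.kids_inj x y B hx hy) (V B)
  -- Summing `hV` and using `h1` and `h2`, the total over all children appears on both sides and
  -- cancels.
  have h3 := Finset.sum_le_sum fun B hB => hV B (Finset.mem_range.1 hB)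
  rw [Finset.sum_add_distrib] at h3
  omega

/-- A procedure which calls itself once for every child cluster halts, and its total cost is the sum
of the costs of the clusters. -/
theorem exists_cost (h : IsForest cl kd rts cnt) (cost : ℕ → ℕ)
    (T : Option (Node n m) → ℕ → ℕ → Prop)
    (hT : ∀ p B f, (∀ x ∈ clusterNodes (cl B), p ≠ some x → ∀ B' ∈ kd x, T (some x) B' (f B')) →
      T p B (cost B + ((clusterNodes (cl B)).map (childCost kd f p)).sum)) :
    ∃ f : ℕ → ℕ, (∀ B ∈ rts, T none B (f B)) ∧
      (rts.map f).sum ≤ ∑ B ∈ Finset.range cnt, (cost B + 3) := by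
  -- The guard `B' < B` makes this a well-founded recursion for arbitrary data; `hW'` removes it for
  -- actual clusters, where `kids_lt_owner` applies. The parent is recognized by `B ∈ kd x`, so that
  -- `W` depends on `B` alone.
  have hrec : ∃ W : ℕ → ℕ, ∀ B, W B = cost B + ((clusterNodes (cl B)).map fun x =>
      if B ∈ kd x then 0 else ((kd x).map fun B' => if B' < B then W B' + 3 else 0).sum).sum := by
    let F : (B : ℕ) → ((B' : ℕ) → B' < B → ℕ) → ℕ := fun B g =>
      cost B + ((clusterNodes (cl B)).map fun x => if B ∈ kd x then 0 else
        ((kd x).map fun B' => if hB : B' < B then g B' hB + 3 else 0).sum).sum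
    refine ⟨WellFounded.fix Nat.lt_wfRel.wf F, fun B => ?_⟩
    rw [WellFounded.fix_eq]
    simp only [F, dite_eq_ite]
  obtain ⟨W, hW⟩ := hrec
  have hW' : ∀ B < cnt, ∀ p, (∀ x, p = some x ↔ B ∈ kd x) →
      ((clusterNodes (cl B)).map (childCost kd W p)).sum = ((clusterNodes (cl B)).map fun x =>
      if B ∈ kd x then 0 else ((kd x).map fun B' => if B' < B then W B' + 3 else 0).sum).sum := by
    intro B hB p hp
    refine congrArg List.sum (List.map_congr_left fun x hx => ?_)
    rw [childCost]
    by_cases hx' : B ∈ kd x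
    · rw [if_pos hx', if_pos ((hp x).2 hx')]
    · rw [if_neg hx', if_neg fun h' => hx' ((hp x).1 h')]
      refine congrArg List.sum (List.map_congr_left fun B' hB' => ?_)
      rw [if_pos (h.kids_lt_owner x B hB hx hx' B' hB')]
  have hT' : ∀ B, B < cnt → ∀ p, (∀ x, p = some x ↔ B ∈ kd x) → T p B (W B) := by
    intro B
    induction B using Nat.strong_induction_on with
    | _ B ih =>
      intro hB p hp
      rw [hW B, ← hW' B hB p hp]
      refine hT p B W fun x hx hpx B' hB' => ?_
      have hx' : B ∉ kd x := fun h' => hpx ((hp x).2 h')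
      refine ih B' (h.kids_lt_owner x B hB hx hx' B' hB') (h.kids_lt x B' hB') _ fun y => ?_
      rw [Option.some.injEq]
      exact ⟨fun e => e ▸ hB', fun e => h.kids_inj x y B' hB' e⟩
  refine ⟨W, fun B hB => hT' B (h.roots_lt B hB) none fun x => ?_, ?_⟩
  · simpa using h.roots_not_mem B hB x
  -- Passing to `W B + 3` absorbs the surcharge per child into the cost of the child itself.
  · refine le_trans ?_ (h.sum_roots_le (fun B => cost B + 3) (fun B => W B + 3) fun B hB => ?_)
    · rw [sum_kids_add]
      omega
    · rw [hW B, add_right_comm]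
      refine Nat.add_le_add_left (List.sum_le_sum fun x _ => ?_) _
      split_ifs
      · exact le_rfl
      · refine List.sum_le_sum fun B' _ => ?_
        split_ifs <;> omega

/-- Both stages are summed over the same forest, which `Frame` keeps unchanged while the roots are
processed alternately by the two procedures. The square is bounded via `(C + 2) ^ 2 ≤ 8 * (C ^ 2 +
1)`. -/
theorem within_recursiveCompute_forM (h : IsForest cl kd rts cnt) (s : Fin m → Bit) (C : ℕ)
    (hC : ∀ B < cnt, (cl B).vars.length ≤ C) :
    Within (Frame cl kd rts)
      (2000 * ((C ^ 2 + 1) * ∑ B ∈ Finset.range cnt, dataSize (cl B)))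
      (rts.forM fun B => do
        recursiveCompute s none B
        recursiveSelect s none B 0) fun _ => True := by
  obtain ⟨f, hf, hfs⟩ := h.exists_cost
    (fun B => 100 * (dataSize (cl B) * ((cl B).vars.length + 2) ^ 2))
    (fun p B k => Within (Frame cl kd rts) k (recursiveCompute s p B) fun _ => True)
    fun p B f hf => within_recursiveCompute s p B f hf
  obtain ⟨g, hg, hgs⟩ := h.exists_cost (fun B => 10 * dataSize (cl B))
    (fun p B k => ∀ b, Within (Frame cl kd rts) k (recursiveSelect s p B b) fun _ => True)
    fun p B f hf b => within_recursiveSelect s p B b f fun x hx hp B' hB' b' => hf x hx hp B' hB' b'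
  refine (Within.forM (c := fun B => f B + g B) fun B hB =>
    (hf B hB).bind fun _ _ => hg B hB 0).mono ?_
  rw [List.sum_map_add, Finset.mul_sum, Finset.mul_sum]
  refine (Nat.add_le_add hfs hgs).trans ?_
  rw [← Finset.sum_add_distrib]
  refine Finset.sum_le_sum fun B hB => ?_
  have hB := hC B (Finset.mem_range.1 hB)
  have h1 : 1 ≤ dataSize (cl B) := by simp only [dataSize]; omega
  generalize dataSize (cl B) = d at *
  have h2 : ((cl B).vars.length + 2) ^ 2 ≤ 8 * (C ^ 2 + 1) := by
    have h3 := Nat.pow_le_pow_left (Nat.add_le_add_right hB 2) 2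
    have h4 := Nat.le_self_pow two_ne_zero C
    nlinarith
  nlinarith [Nat.mul_le_mul_left d h2, Nat.zero_le (d * C ^ 2)]

end IsForest

end RAM

/-! ### Symbolic execution of the search and the forest invariant -/

namespace RAM

variable {n m : ℕ} {α β : Type}

/-- Started in the state `s`, the computation `p` halts with a value and a state which satisfy `Q`. -/
def Run (p : RAM n m α) (s : Mem n m) (Q : α → Mem n m → Prop) : Prop :=
  ∃ a s', p s = some (a, s') ∧ Q a s'

/-- The search changes the forest itself, so a fixed invariant as in `Within` is not enough. The
equivalences for `Run` let the simplifier execute straight-line code symbolically. -/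
theorem run_bind {p : RAM n m α} {f : α → RAM n m β} {s : Mem n m} {Q : β → Mem n m → Prop} :
    Run (p >>= f) s Q ↔ Run p s fun a s' => Run (f a) s' Q := by
  have : (p >>= f) s = (p s).bind fun r => f r.1 r.2 := rfl
  unfold Run
  rw [this]
  rcases p s with _ | ⟨a, s'⟩ <;> simp

theorem run_pure {a : α} {s : Mem n m} {Q : α → Mem n m → Prop} :
    Run (pure a) s Q ↔ Q a s :=
  ⟨by rintro ⟨_, _, h, hQ⟩; cases h; exact hQ, fun h => ⟨_, _, rfl, h⟩⟩

theorem run_tick {s : Mem n m} {Q : Unit → Mem n m → Prop} :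
    Run tick s Q ↔ Q () { s with time := s.time + 1 } :=
  ⟨by rintro ⟨_, _, h, hQ⟩; cases h; exact hQ, fun h => ⟨_, _, rfl, h⟩⟩

theorem run_rd {f : Mem n m → α} {s : Mem n m} {Q : α → Mem n m → Prop} :
    Run (rd f) s Q ↔ Q (f s) { s with time := s.time + 1 } :=
  ⟨by rintro ⟨_, _, h, hQ⟩; cases h; exact hQ, fun h => ⟨_, _, rfl, h⟩⟩

theorem run_wr {f : Mem n m → Mem n m} {s : Mem n m} {Q : Unit → Mem n m → Prop} :
    Run (wr f) s Q ↔ Q () { f s with time := s.time + 1 } :=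
  ⟨by rintro ⟨_, _, h, hQ⟩; cases h; exact hQ, fun h => ⟨_, _, rfl, h⟩⟩

theorem Run.imp {p : RAM n m α} {s : Mem n m} {Q Q' : α → Mem n m → Prop} (h : Run p s Q)
    (hQ : ∀ a s', Q a s' → Q' a s') : Run p s Q' := by
  obtain ⟨a, s', h1, h2⟩ := h
  exact ⟨a, s', h1, hQ a s' h2⟩

/-! ### Building one cluster -/

/-- The total length of the neighbour lists that are being built. -/
def nbSize (nb : Fin m → List (Fin n)) : ℕ := ∑ c, (nb c).length

theorem nbSize_update (nb : Fin m → List (Fin n)) (c : Fin m) (l : List (Fin n)) :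
    nbSize (Function.update nb c l) + (nb c).length = nbSize nb + l.length := by
  unfold nbSize
  rw [← Finset.add_sum_erase _ _ (Finset.mem_univ c),
    ← Finset.add_sum_erase (a := c) _ (fun c => (nb c).length) (Finset.mem_univ c),
    Function.update_self, Finset.sum_congr rfl fun x hx => by
      rw [Function.update_of_ne (Finset.ne_of_mem_erase hx)]]
  omega

/-- The end nodes of the tree edges on a stack. -/
def treeEnds (st : List (StackEdge n m)) : List (Node n m) := (st.filter (·.tree)).map (·.dst)

/-- The nodes in the node lists of a cluster that is being built. -/
def accNodes (acc : List (Fin n) × List (Fin m)) : List (Node n m) :=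
  acc.1.map Sum.inl ++ acc.2.map Sum.inr

theorem accNodes_addNode (a : Node n m) (acc : List (Fin n) × List (Fin m)) :
    (accNodes (addNode a acc)).Perm (a :: accNodes acc) := by
  rcases a with v | c
  · exact List.Perm.refl _
  · simp only [accNodes, addNode, List.map_cons]
    exact List.perm_middle

theorem run_recordEdge (a b : Node n m) (s : Mem n m) :
    Run (recordEdge a b) s fun _ s' => ∃ nb t, s' = { s with nb := nb, time := t } ∧
      t ≤ s.time + 2 ∧ nbSize nb ≤ nbSize s.nb + 1 := by
  rcases a with v | c <;> rcases b with w | d <;>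
    simp only [recordEdge, run_bind, run_tick, run_rd, run_wr]
  · exact ⟨s.nb, s.time + 1, rfl, by omega, by omega⟩
  · refine ⟨_, _, rfl, le_rfl, ?_⟩
    have := nbSize_update s.nb d (v :: s.nb d)
    rw [List.length_cons] at this
    omega
  · refine ⟨_, _, rfl, le_rfl, ?_⟩
    have := nbSize_update s.nb c (w :: s.nb c)
    rw [List.length_cons] at this
    omega
  · exact ⟨s.nb, s.time + 1, rfl, by omega, by omega⟩

/-- Since `w` is not the end of a tree edge in `ext`, popping cannot stop before the displayed edge.
Each popped edge costs at most three steps and creates at most one neighbour entry. -/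
theorem run_popCluster (v w : Node n m) (ext st : List (StackEdge n m)) (hw : w ∉ treeEnds ext)
    (acc : List (Fin n) × List (Fin m)) (s : Mem n m) :
    Run (popCluster v w (ext ++ ⟨v, w, true⟩ :: st) acc) s fun r s' => r.2 = st ∧
      (accNodes r.1).Perm (treeEnds ext ++ w :: accNodes acc) ∧
      ∃ nb t, s' = { s with nb := nb, time := t } ∧ t ≤ s.time + 3 * (ext.length + 1) ∧
        nbSize nb ≤ nbSize s.nb + (ext.length + 1) := by
  induction ext generalizing acc s with
  | nil =>
    simp only [List.nil_append, popCluster, run_bind, run_tick]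
    refine (run_recordEdge v w _).imp fun _ s' ⟨nb, t, hs, ht, hnb⟩ => ?_
    simp only [if_true, and_self, run_pure]
    dsimp only at ht
    refine ⟨trivial, accNodes_addNode w acc, nb, t, hs, ?_, by simpa using hnb⟩
    simp only [List.length_nil]
    omega
  | cons e ext ih =>
    simp only [List.cons_append, popCluster, run_bind, run_tick]
    refine (run_recordEdge e.src e.dst _).imp fun _ s' ⟨nb, t, hs, ht, hnb⟩ => ?_
    dsimp only at ht hnb
    rcases e with ⟨a, b, _ | _⟩
    · refine (ih hw acc s').imp fun r s'' ⟨h1, h2, nb', t', hs', ht', hnb'⟩ =>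
        ⟨h1, h2, nb', t', ?_, ?_, ?_⟩
      · rw [hs', hs]
      · rw [hs] at ht'; simp only [List.length_cons]; dsimp only at ht'; omega
      · rw [hs] at hnb'; simp only [List.length_cons]; dsimp only at hnb'; omega
    · have hw' : w ≠ b ∧ w ∉ treeEnds ext := by
        simpa [treeEnds] using hw
      have hb : ¬ (a = v ∧ b = w) := fun h => hw'.1 h.2.symm
      simp only [if_true, if_neg hb]
      refine (ih hw'.2 (addNode b acc) s').imp fun r s'' ⟨h1, h2, nb', t', hs', ht', hnb'⟩ =>
        ⟨h1, h2.trans ?_, nb', t', ?_, ?_, ?_⟩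
      · have : treeEnds (⟨a, b, true⟩ :: ext) = b :: treeEnds ext := rfl
        rw [this, List.cons_append]
        refine (((accNodes_addNode b acc).cons w).append_left _).trans ?_
        refine ((List.Perm.swap b w _).append_left _).trans ?_
        exact List.perm_middle
      · rw [hs', hs]
      · rw [hs] at ht'; simp only [List.length_cons]; dsimp only at ht'; omega
      · rw [hs] at hnb'; simp only [List.length_cons]; dsimp only at hnb'; omega

/-- Each list is reset when it is fetched, so entries move from `nb` into the cluster without being
counted twice. -/
theorem run_collectChecks (cs : List (Fin m)) (s : Mem n m) :
    Run (collectChecks cs) s fun r s' => r.map Prod.fst = cs ∧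
      ∃ nb t, s' = { s with nb := nb, time := t } ∧ t ≤ s.time + 3 * cs.length + 1 ∧
        edgeCount r + nbSize nb ≤ nbSize s.nb := by
  induction cs generalizing s with
  | nil =>
    simp only [collectChecks, run_bind, run_tick, run_pure]
    exact ⟨rfl, s.nb, _, rfl, by simp, by simp [edgeCount]⟩
  | cons c cs ih =>
    simp only [collectChecks, run_bind, run_tick, run_pure, run_rd, run_wr]
    refine (ih _).imp fun r s' ⟨h1, nb, t, hs, ht, hnb⟩ => ⟨by simp [h1], nb, t, hs, ?_, ?_⟩
    · simp only [List.length_cons]; dsimp only at ht; omega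
    · have := nbSize_update s.nb c []
      dsimp only at hnb
      simp only [edgeCount, List.map_cons, List.sum_cons, List.length_nil] at hnb this ⊢
      omega

theorem run_newCluster (acc : List (Fin n) × List (Fin m)) (s : Mem n m) :
    Run (newCluster acc) s fun B s' => B = s.cnt ∧ ∃ nb t c,
      s' = { s with nb := nb, time := t, cnt := s.cnt + 1,
                    cluster := Function.update s.cluster s.cnt c } ∧
      clusterNodes c = accNodes acc ∧
      t + dataSize c + nbSize nb ≤ s.time + nbSize s.nb + 4 * (accNodes acc).length + 5 := by
  simp only [newCluster, run_bind, run_rd, run_wr, run_pure]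
  refine (run_collectChecks acc.2 s).imp fun r s' ⟨h1, nb, t, hs, ht, hnb⟩ => ?_
  subst hs
  refine ⟨rfl, nb, t + 3, ⟨acc.1, r⟩, rfl, ?_, ?_⟩
  · simp only [clusterNodes, accNodes, ← h1, List.map_map, Function.comp_def]
  · have := congrArg List.length h1
    rw [List.length_map] at this
    simp only [dataSize, accNodes, List.length_append, List.length_map]
    omega

/-! ### Invariant of the depth-first search -/

/-- The node `x` lies in a cluster of which it is not the parent. -/
def Owned (cl : ℕ → Cluster n m) (kd : Node n m → List ℕ) (cnt : ℕ) (x : Node n m) : Prop :=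
  ∃ B < cnt, x ∈ clusterNodes (cl B) ∧ B ∉ kd x

/-- Invariant of the depth-first search: the clusters found so far form a forest, and the end nodes of
the tree edges on the stack are distinct discovered nodes which still have to find their cluster. -/
structure SearchInv (num : Node n m → ℕ) (st : List (StackEdge n m)) (cl : ℕ → Cluster n m)
    (kd : Node n m → List ℕ) (rts : List ℕ) (cnt : ℕ) : Prop extends
    IsForest cl kd rts cnt where
  owned_discovered : ∀ x, Owned cl kd cnt x → num x ≠ 0
  owned_not_mem : ∀ x, Owned cl kd cnt x → x ∉ treeEnds st
  ends_nodup : (treeEnds st).Nodup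
  ends_discovered : ∀ x ∈ treeEnds st, num x ≠ 0

theorem treeEnds_append (a b : List (StackEdge n m)) :
    treeEnds (a ++ b) = treeEnds a ++ treeEnds b := by
  simp [treeEnds]

namespace SearchInv

variable {num : Node n m → ℕ} {st : List (StackEdge n m)} {cl : ℕ → Cluster n m}
  {kd : Node n m → List ℕ} {rts : List ℕ} {cnt : ℕ}

theorem push_back (h : SearchInv num st cl kd rts cnt) (v w : Node n m) :
    SearchInv num (⟨v, w, false⟩ :: st) cl kd rts cnt :=
  { h with }

theorem discover (h : SearchInv num st cl kd rts cnt) (w : Node n m) (k : ℕ) :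
    SearchInv (Function.update num w (k + 1)) st cl kd rts cnt := by
  have hne : ∀ x, num x ≠ 0 → Function.update num w (k + 1) x ≠ 0 := fun x hx => by
    by_cases hxw : x = w
    · simp [hxw]
    · simpa [hxw] using hx
  exact { h with
    owned_discovered := fun x hx => hne x (h.owned_discovered x hx)
    ends_discovered := fun x hx => hne x (h.ends_discovered x hx) }

/-- A node that was undiscovered can neither be owned nor be a tree end on the stack. -/
theorem push_tree (h : SearchInv num st cl kd rts cnt) (v w : Node n m) (hw : num w = 0) (k : ℕ) :
    SearchInv (Function.update num w (k + 1)) (⟨v, w, true⟩ :: st) cl kd rts cnt := by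
  have h' := h.discover w k
  have he : treeEnds (⟨v, w, true⟩ :: st) = w :: treeEnds st := rfl
  have hwe : w ∉ treeEnds st := fun hx => h.ends_discovered w hx hw
  refine { h' with
    owned_not_mem := fun x hx => ?_
    ends_nodup := ?_
    ends_discovered := fun x hx => ?_ }
  · rw [he, List.mem_cons]
    rintro (rfl | hx')
    · exact h.owned_discovered x hx hw
    · exact h.owned_not_mem x hx hx'
  · rw [he]
    exact List.nodup_cons.2 ⟨hwe, h.ends_nodup⟩
  · rw [he, List.mem_cons] at hx
    rcases hx with rfl | hx
    · simp
    · exact h'.ends_discovered x hx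

theorem kids_not_mem_cnt (h : SearchInv num st cl kd rts cnt) (x : Node n m) : cnt ∉ kd x :=
  fun hx => (h.kids_lt x cnt hx).false

/-- Forming a new cluster which is a child of its node `v`. -/
theorem close (h : SearchInv num st cl kd rts cnt) {ends : List (Node n m)}
    {st' : List (StackEdge n m)} (hst : treeEnds st = ends ++ treeEnds st') {v : Node n m}
    {c : Cluster n m} (hv : v ∉ ends) (hvo : ¬ Owned cl kd cnt v)
    (hc : (clusterNodes c).Perm (v :: ends)) :
    SearchInv num st' (Function.update cl cnt c) (Function.update kd v (cnt :: kd v)) rts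
        (cnt + 1) ∧
      ∀ x, Owned (Function.update cl cnt c) (Function.update kd v (cnt :: kd v)) (cnt + 1) x →
        Owned cl kd cnt x ∨ x ∈ ends := by
  have hmem : ∀ x B, B ∈ Function.update kd v (cnt :: kd v) x ↔
      B ∈ kd x ∨ (x = v ∧ B = cnt) := fun x B => by
    by_cases hx : x = v
    · subst hx; simp [or_comm]
    · simp [hx]
  have hown : ∀ x, ∀ B < cnt + 1, x ∈ clusterNodes (Function.update cl cnt c B) →
      B ∉ Function.update kd v (cnt :: kd v) x →
      (B < cnt ∧ x ∈ clusterNodes (cl B) ∧ B ∉ kd x) ∨ (B = cnt ∧ x ∈ ends) := by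
    intro x B hB hx hk
    rw [hmem, not_or] at hk
    rcases Nat.lt_succ_iff_lt_or_eq.1 hB with hB | rfl
    · rw [Function.update_of_ne hB.ne] at hx
      exact Or.inl ⟨hB, hx, hk.1⟩
    · rw [Function.update_self, hc.mem_iff, List.mem_cons] at hx
      refine Or.inr ⟨rfl, hx.resolve_left fun e => hk.2 ⟨e, rfl⟩⟩
  have hno : ∀ x ∈ ends, ¬ Owned cl kd cnt x := fun x hx ho =>
    h.owned_not_mem x ho (by rw [hst]; exact List.mem_append_left _ hx)
  have hnd := h.ends_nodup
  rw [hst] at hnd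
  have hown' : ∀ x, Owned (Function.update cl cnt c) (Function.update kd v (cnt :: kd v))
      (cnt + 1) x → Owned cl kd cnt x ∨ x ∈ ends := fun x ⟨B, hB, hx, hk⟩ =>
    (hown x B hB hx hk).imp (fun h' => ⟨B, h'⟩) fun h' => h'.2
  refine ⟨⟨⟨fun x => ?_, fun x B hB => ?_, fun x y B hx hy => ?_, h.roots_nodup,
    fun B hB => (h.roots_lt B hB).trans (Nat.lt_succ_self _), fun B hB x hx => ?_,
    fun B hB => ?_, fun x B hB B' hB' h1 h2 h3 h4 => ?_, fun x B hB h1 h2 B' hB' => ?_⟩,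
    fun x hx => ?_, fun x hx hx' => ?_, (List.nodup_append.1 hnd).2.1, fun x hx =>
      h.ends_discovered x (by rw [hst]; exact List.mem_append_right _ hx)⟩, hown'⟩
  · by_cases hx : x = v
    · subst hx
      rw [Function.update_self]
      exact List.pairwise_cons.2 ⟨fun B hB => h.kids_lt x B hB, h.kids_pairwise x⟩
    · rw [Function.update_of_ne hx]
      exact h.kids_pairwise x
  · rcases (hmem x B).1 hB with hB | ⟨-, rfl⟩
    · exact (h.kids_lt x B hB).trans (Nat.lt_succ_self _)
    · exact Nat.lt_succ_self _
  · rcases (hmem x B).1 hx with hx | ⟨hx, hB⟩ <;> rcases (hmem y B).1 hy with hy | ⟨hy, hB'⟩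
    · exact h.kids_inj x y B hx hy
    · exact absurd (hB' ▸ hx) (h.kids_not_mem_cnt x)
    · exact absurd (hB ▸ hy) (h.kids_not_mem_cnt y)
    · rw [hx, hy]
  · rcases (hmem x B).1 hx with hx | ⟨-, rfl⟩
    · exact h.roots_not_mem B hB x hx
    · exact (h.roots_lt B hB).false
  · rcases Nat.lt_succ_iff_lt_or_eq.1 hB with hB | rfl
    · rw [Function.update_of_ne hB.ne]
      exact h.nodes_nodup B hB
    · rw [Function.update_self, hc.nodup_iff]
      exact List.nodup_cons.2 ⟨hv, (List.nodup_append.1 hnd).1⟩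
  · rcases hown x B hB h1 h2 with g | ⟨g, g1⟩ <;> rcases hown x B' hB' h3 h4 with g' | ⟨g', g2⟩
    · exact h.owner_unique x B g.1 B' g'.1 g.2.1 g.2.2 g'.2.1 g'.2.2
    · exact absurd ⟨B, g⟩ (hno x g2)
    · exact absurd ⟨B', g'⟩ (hno x g1)
    · rw [g, g']
  -- The new child `cnt` of `v` exceeds every older number, which is harmless because `v` has no
  -- owner yet. The new cluster, as owner, exceeds all children of its nodes.
  · rcases hown x B hB h1 h2 with g | ⟨rfl, g1⟩ <;> rcases (hmem x B').1 hB' with hB' | ⟨rfl, -⟩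
    · exact h.kids_lt_owner x B g.1 g.2.1 g.2.2 B' hB'
    · exact absurd ⟨B, g⟩ hvo
    · exact h.kids_lt x B' hB'
    · exact absurd g1 hv
  · rcases hown' x hx with hx | hx
    · exact h.owned_discovered x hx
    · exact h.ends_discovered x (by rw [hst]; exact List.mem_append_left _ hx)
  · rcases hown' x hx with hx | hx
    · exact h.owned_not_mem x hx (by rw [hst]; exact List.mem_append_right _ hx')
    · exact (List.nodup_append.1 hnd).2.2 x hx x hx' rfl

/-- An isolated node becomes a root cluster. -/
theorem isolated (h : SearchInv num st cl kd rts cnt) {r : Node n m} {c : Cluster n m}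
    (hk : kd r = []) (hr : num r ≠ 0) (hrs : r ∉ treeEnds st) (hro : ¬ Owned cl kd cnt r)
    (hc : clusterNodes c = [r]) :
    SearchInv num st (Function.update cl cnt c) kd (cnt :: rts) (cnt + 1) := by
  have hown : ∀ x, ∀ B < cnt + 1, x ∈ clusterNodes (Function.update cl cnt c B) → B ∉ kd x →
      (B < cnt ∧ x ∈ clusterNodes (cl B) ∧ B ∉ kd x) ∨ (B = cnt ∧ x = r) := by
    intro x B hB hx hk
    rcases Nat.lt_succ_iff_lt_or_eq.1 hB with hB | rfl
    · rw [Function.update_of_ne hB.ne] at hx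
      exact Or.inl ⟨hB, hx, hk⟩
    · rw [Function.update_self, hc, List.mem_singleton] at hx
      exact Or.inr ⟨rfl, hx⟩
  have hown' : ∀ x, Owned (Function.update cl cnt c) kd (cnt + 1) x →
      Owned cl kd cnt x ∨ x = r := fun x ⟨B, hB, hx, hk⟩ =>
    (hown x B hB hx hk).imp (fun h' => ⟨B, h'⟩) fun h' => h'.2
  refine ⟨⟨h.kids_pairwise, fun x B hB => (h.kids_lt x B hB).trans (Nat.lt_succ_self _),
    h.kids_inj, ?_, fun B hB => ?_, fun B hB x hx => ?_,
    fun B hB => ?_, fun x B hB B' hB' h1 h2 h3 h4 => ?_, fun x B hB h1 h2 B' hB' => ?_⟩,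
    fun x hx => ?_, fun x hx hx' => ?_, h.ends_nodup, h.ends_discovered⟩
  · exact List.nodup_cons.2 ⟨fun hx => (h.roots_lt _ hx).false, h.roots_nodup⟩
  · rcases List.mem_cons.1 hB with rfl | hB
    · exact Nat.lt_succ_self _
    · exact (h.roots_lt B hB).trans (Nat.lt_succ_self _)
  · rcases List.mem_cons.1 hB with rfl | hB
    · exact h.kids_not_mem_cnt x hx
    · exact h.roots_not_mem B hB x hx
  · rcases Nat.lt_succ_iff_lt_or_eq.1 hB with hB | rfl
    · rw [Function.update_of_ne hB.ne]
      exact h.nodes_nodup B hB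
    · rw [Function.update_self, hc]
      exact List.nodup_singleton r
  · rcases hown x B hB h1 h2 with g | ⟨g, g1⟩ <;> rcases hown x B' hB' h3 h4 with g' | ⟨g', g2⟩
    · exact h.owner_unique x B g.1 B' g'.1 g.2.1 g.2.2 g'.2.1 g'.2.2
    · exact absurd ⟨B, g⟩ (g2 ▸ hro)
    · exact absurd ⟨B', g'⟩ (g1 ▸ hro)
    · rw [g, g']
  · rcases hown x B hB h1 h2 with g | ⟨rfl, rfl⟩
    · exact h.kids_lt_owner x B g.1 g.2.1 g.2.2 B' hB'
    · rw [hk] at hB'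
      simp at hB'
  · rcases hown' x hx with hx | rfl
    · exact h.owned_discovered x hx
    · exact hr
  · rcases hown' x hx with hx | rfl
    · exact h.owned_not_mem x hx hx'
    · exact hrs hx'

/-- The last child cluster of the node `r` becomes a root cluster. -/
theorem promote (h : SearchInv num st cl kd rts cnt) {r : Node n m} {B₀ : ℕ} {ks : List ℕ}
    (hk : kd r = B₀ :: ks) (hr : num r ≠ 0) (hrs : r ∉ treeEnds st) (hro : ¬ Owned cl kd cnt r) :
    SearchInv num st cl (Function.update kd r ks) (B₀ :: rts) cnt := by
  -- The head `B₀` is the largest child. It becomes the owner of `r`, so the order required between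
  -- owner and remaining children holds.
  have hp := h.kids_pairwise r
  rw [hk, List.pairwise_cons] at hp
  have hmem : ∀ x B, B ∈ Function.update kd r ks x → B ∈ kd x ∧ B ≠ B₀ := fun x B hB => by
    by_cases hx : x = r
    · subst hx
      rw [Function.update_self] at hB
      exact ⟨by rw [hk]; exact List.mem_cons_of_mem _ hB, (hp.1 B hB).ne⟩
    · rw [Function.update_of_ne hx] at hB
      refine ⟨hB, ?_⟩
      rintro rfl
      exact hx (h.kids_inj x r B hB (by simp [hk]))
  have hown : ∀ x, ∀ B < cnt, x ∈ clusterNodes (cl B) → B ∉ Function.update kd r ks x →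
      (B < cnt ∧ x ∈ clusterNodes (cl B) ∧ B ∉ kd x) ∨ (B = B₀ ∧ x = r) := by
    intro x B hB hx hk'
    by_cases hxr : x = r
    · subst hxr
      rw [Function.update_self] at hk'
      by_cases hBB : B = B₀
      · exact Or.inr ⟨hBB, rfl⟩
      · exact Or.inl ⟨hB, hx, by simp [hk, hBB, hk']⟩
    · rw [Function.update_of_ne hxr] at hk'
      exact Or.inl ⟨hB, hx, hk'⟩
  have hown' : ∀ x, Owned cl (Function.update kd r ks) cnt x →
      Owned cl kd cnt x ∨ x = r := fun x ⟨B, hB, hx, hk⟩ =>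
    (hown x B hB hx hk).imp (fun h' => ⟨B, h'⟩) fun h' => h'.2
  have hB₀ : B₀ ∈ kd r := by simp [hk]
  refine ⟨⟨fun x => ?_, fun x B hB => h.kids_lt x B (hmem x B hB).1,
    fun x y B hx hy => h.kids_inj x y B (hmem x B hx).1 (hmem y B hy).1, ?_, fun B hB => ?_,
    fun B hB x hx => ?_, h.nodes_nodup, fun x B hB B' hB' h1 h2 h3 h4 => ?_,
    fun x B hB h1 h2 B' hB' => ?_⟩,
    fun x hx => ?_, fun x hx hx' => ?_, h.ends_nodup, h.ends_discovered⟩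
  · by_cases hx : x = r
    · subst hx
      rw [Function.update_self]
      exact hp.2
    · rw [Function.update_of_ne hx]
      exact h.kids_pairwise x
  · exact List.nodup_cons.2 ⟨fun hx => h.roots_not_mem _ hx r hB₀, h.roots_nodup⟩
  · rcases List.mem_cons.1 hB with rfl | hB
    · exact h.kids_lt r B hB₀
    · exact h.roots_lt B hB
  · rcases List.mem_cons.1 hB with rfl | hB
    · exact (hmem x B hx).2 rfl
    · exact h.roots_not_mem B hB x (hmem x B hx).1
  · rcases hown x B hB h1 h2 with g | ⟨g, g1⟩ <;> rcases hown x B' hB' h3 h4 with g' | ⟨g', g2⟩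
    · exact h.owner_unique x B g.1 B' g'.1 g.2.1 g.2.2 g'.2.1 g'.2.2
    · exact absurd ⟨B, g⟩ (g2 ▸ hro)
    · exact absurd ⟨B', g'⟩ (g1 ▸ hro)
    · rw [g, g']
  · rcases hown x B hB h1 h2 with g | ⟨rfl, rfl⟩
    · exact h.kids_lt_owner x B g.1 g.2.1 g.2.2 B' (hmem x B' hB').1
    · rw [Function.update_self] at hB'
      exact hp.1 B' hB'
  · rcases hown' x hx with hx | rfl
    · exact h.owned_discovered x hx
    · exact hr
  · rcases hown' x hx with hx | rfl
    · exact h.owned_not_mem x hx hx'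
    · exact hrs hx'

end SearchInv

end RAM

/-! ### Amortized analysis of the depth-first search -/

namespace RAM

variable {n m : ℕ}

/-- The invariant of the depth-first search, for the contents of the memory. -/
abbrev Searching (s : Mem n m) : Prop := SearchInv s.num s.stack s.cluster s.kids s.roots s.cnt

/-- The depth-first search, running below nodes that were discovered in the state `s`, can reach the
state `s'`. -/
structure Later (s s' : Mem n m) : Prop where
  num : ∀ x, s.num x ≠ 0 → s'.num x ≠ 0
  stack : ∃ ext, s'.stack = ext ++ s.stack ∧ ∀ x ∈ treeEnds ext, s.num x = 0
  owned : ∀ x, s.num x ≠ 0 → Owned s'.cluster s'.kids s'.cnt x → Owned s.cluster s.kids s.cnt x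
  chosen : s'.chosen = s.chosen

theorem Later.trans {s s' s'' : Mem n m} (h : Later s s') (h' : Later s' s'') : Later s s'' := by
  obtain ⟨ext, h1, h2⟩ := h.stack
  obtain ⟨ext', h1', h2'⟩ := h'.stack
  refine ⟨fun x hx => h'.num x (h.num x hx), ⟨ext' ++ ext, by rw [h1', h1, List.append_assoc], ?_⟩,
    fun x hx ho => h.owned x hx (h'.owned x (h.num x hx) ho), h'.chosen.trans h.chosen⟩
  intro x hx
  rw [treeEnds_append, List.mem_append] at hx
  rcases hx with hx | hx
  · by_contra hn
    exact h.num x hn (h2' x hx)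
  · exact h2 x hx

variable (G : AdjList (Node n m))

/-- The steps set aside for a node that is not yet discovered. -/
def reserve (x : Node n m) : ℕ := 60 * (G.nbrs x).length + 40

/-- The steps set aside for all nodes that are not yet discovered. -/
def unexplored (num : Node n m → ℕ) : ℕ :=
  (G.nodes.map fun x => if num x = 0 then reserve G x else 0).sum

/-- Elapsed time plus the steps set aside for unfinished tasks, plus the size of the data written so
far. -/
def potential (s : Mem n m) : ℕ :=
  s.time + 10 * s.stack.length + ∑ B ∈ Finset.range s.cnt, dataSize (s.cluster B) + nbSize s.nb +
    unexplored G s.num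

variable {G}

theorem unexplored_le {num num' : Node n m → ℕ} (h : ∀ x, num x ≠ 0 → num' x ≠ 0) :
    unexplored G num' ≤ unexplored G num := by
  refine List.sum_le_sum fun x _ => ?_
  by_cases hx : num x = 0
  · rw [if_pos hx]
    split_ifs <;> omega
  · simp [hx, h x hx]

/-- Discovering `w` releases its reserve at least once, and no other summand grows. -/
theorem unexplored_update {num : Node n m → ℕ} {w : Node n m} (hw : w ∈ G.nodes)
    (h : num w = 0) (k : ℕ) :
    unexplored G (Function.update num w (k + 1)) + reserve G w ≤ unexplored G num := by
  unfold unexplored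
  generalize G.nodes = l at hw
  have key : ∀ l : List (Node n m), (l.map fun x =>
      if Function.update num w (k + 1) x = 0 then reserve G x else 0).sum ≤
      (l.map fun x => if num x = 0 then reserve G x else 0).sum := fun l =>
    List.sum_le_sum fun x _ => by
      by_cases hx : x = w
      · subst hx; simp
      · simp [hx]
  induction l with
  | nil => simp at hw
  | cons a l ih =>
    rw [List.map_cons, List.sum_cons, List.map_cons, List.sum_cons]
    by_cases ha : a = w
    · subst ha
      have := key l
      rw [Function.update_self, if_neg (Nat.succ_ne_zero k), if_pos h]
      omega
    · have := ih ((List.mem_cons.1 hw).resolve_left (Ne.symm ha))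
      rw [Function.update_of_ne ha]
      omega

theorem sum_dataSize_update (cl : ℕ → Cluster n m) (cnt : ℕ) (c : Cluster n m) :
    ∑ B ∈ Finset.range (cnt + 1), dataSize (Function.update cl cnt c B) =
      (∑ B ∈ Finset.range cnt, dataSize (cl B)) + dataSize c := by
  rw [Finset.sum_range_succ, Function.update_self]
  congr 1
  refine Finset.sum_congr rfl fun B hB => ?_
  rw [Function.update_of_ne (Finset.mem_range.1 hB).ne]

/-- An edge of `ext` accounts for at most 3 steps of popping, one neighbour entry, and 4 units for
its end node (time and data together); the 10 units deposited for it on the stack cover these 8.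
Only a constant remains. -/
theorem run_closeCluster {s : Mem n m} (h : Searching s) {ext st : List (StackEdge n m)}
    {v w : Node n m} (hst : s.stack = ext ++ ⟨v, w, true⟩ :: st) (hv : v ∉ treeEnds ext)
    (hvw : v ≠ w) (hvo : ¬ Owned s.cluster s.kids s.cnt v) :
    Run (closeCluster v w) s fun _ s' => Searching s' ∧ s'.stack = st ∧ s'.num = s.num ∧
      (∀ x, Owned s'.cluster s'.kids s'.cnt x →
        Owned s.cluster s.kids s.cnt x ∨ x ∈ treeEnds ext ∨ x = w) ∧
      s'.chosen = s.chosen ∧ potential G s' ≤ potential G s + 20 := by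
  have hends : treeEnds s.stack = (treeEnds ext ++ [w]) ++ treeEnds st := by
    rw [hst, treeEnds_append, List.append_assoc]
    rfl
  have hw : w ∉ treeEnds ext := by
    have := h.ends_nodup
    rw [hends, List.nodup_append, List.nodup_append] at this
    exact fun hx => this.1.2.2 w hx w (by simp) rfl
  simp only [closeCluster, run_bind, run_rd, run_wr, hst]
  refine (run_popCluster v w ext st hw _ _).imp fun r s₁ ⟨hr, hperm, nb₁, t₁, hs₁, ht₁, hnb₁⟩ => ?_
  refine (run_newCluster r.1 _).imp fun B s₂ ⟨hB, nb₂, t₂, c, hs₂, hc, ht₂⟩ => ?_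
  subst hs₁
  subst hs₂
  subst hB
  rw [hr]
  dsimp only at ht₁ hnb₁ ht₂ ⊢
  have hperm' : (accNodes r.1).Perm (v :: (treeEnds ext ++ [w])) := by
    refine hperm.trans ?_
    have h1 : accNodes (addNode v (([], []) : List (Fin n) × List (Fin m))) = [v] := by
      rcases v with v | v <;> rfl
    rw [h1]
    refine List.Perm.trans ?_ (List.perm_append_singleton v _)
    rw [List.append_assoc]
    exact List.Perm.refl _
  obtain ⟨h1, h2⟩ := h.close (st' := st) (c := c) hends (by simp [hv, hvw]) hvo (hc ▸ hperm')
  refine ⟨h1, rfl, rfl, fun x hx => (h2 x hx).imp_right (by simp), rfl, ?_⟩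
  have hlen := hperm'.length_eq
  have hlen' : (treeEnds ext).length ≤ ext.length := by
    rw [treeEnds, List.length_map]
    exact List.length_filter_le _ _
  simp only [List.length_cons, List.length_append, List.length_nil] at hlen
  simp only [potential, sum_dataSize_update, hst, List.length_append, List.length_cons]
  omega

/-- The outer induction is on a bound for the unexplored reserve, which drops strictly with each
discovery; the inner one is on the rest of the neighbour list. `Later` carries what the caller needs
afterwards: its own node is still unowned, and the stack has only grown by edges whose tree ends are
new. -/
theorem run_scan (hG : ∀ a ∈ G.nodes, ∀ b ∈ G.nbrs a, b ∈ G.nodes) (N : ℕ) :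
    ∀ (ws : List (Node n m)) (u : Option (Node n m)) (v : Node n m) (s : Mem n m),
      unexplored G s.num ≤ N → (∀ w ∈ ws, w ∈ G.nodes) → s.num v ≠ 0 →
      ¬ Owned s.cluster s.kids s.cnt v → Searching s →
      Run (scan G u v ws) s fun _ s' => Searching s' ∧ Later s s' ∧
        potential G s' ≤ potential G s + 60 * ws.length + 1 := by
  induction N using Nat.strong_induction_on with
  | _ N ihN =>
  intro ws
  induction ws with
  | nil =>
    intro u v s _ _ _ _ h
    rw [scan, run_tick]
    refine ⟨h, ⟨fun _ h => h, ⟨[], rfl, by simp [treeEnds]⟩, fun _ _ h => h, rfl⟩, ?_⟩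
    simp only [potential, List.length_nil]
    omega
  | cons w ws ih =>
    intro u v s hN hws hv hvo h
    -- All branches continue in the same way, so each only has to show that one list entry raises
    -- the potential by at most 60.
    have tail : ∀ s' : Mem n m, Searching s' → Later s s' → potential G s' ≤ potential G s + 60 →
        Run (scan G u v ws) s' fun _ s'' => Searching s'' ∧ Later s s'' ∧
          potential G s'' ≤ potential G s + 60 * (w :: ws).length + 1 := by
      intro s' h1 h2 h3
      refine (ih u v s' ((unexplored_le h2.num).trans hN) (fun x hx => hws x (by simp [hx]))
        (h2.num v hv) (fun ho => hvo (h2.owned v hv ho)) h1).imp fun _ s'' ⟨g1, g2, g3⟩ =>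
        ⟨g1, h2.trans g2, ?_⟩
      rw [List.length_cons]
      omega
    rw [scan]
    simp only [run_bind, run_tick, run_rd]
    split_ifs with hw hback
    · have hvw : v ≠ w := by
        rintro rfl
        exact hv hw
      have hwG : w ∈ G.nodes := hws w (by simp)
      have hU := unexplored_update hwG hw s.clock
      simp only [push, discover, run_bind, run_rd, run_wr]
      have h1 := h.push_tree v w hw s.clock
      refine (ihN (unexplored G (Function.update s.num w (s.clock + 1)))
        (by simp only [reserve] at hU; omega) (G.nbrs w) (some v) w _ ?_ (hG w hwG) ?_ ?_ ?_).imp ?_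
      · exact le_rfl
      · simp
      · exact fun ho => h.owned_discovered w ho hw
      · exact h1
      rintro _ s₂ ⟨h2, hl, hp⟩
      obtain ⟨ext, hext, hextn⟩ := hl.stack
      dsimp only at hext hextn
      -- Tree ends above the edge to `w` were undiscovered in `s`. Hence `v` is not among them, as
      -- closing the cluster requires.
      have hnew : ∀ x ∈ treeEnds ext, s.num x = 0 ∧ x ≠ w := fun x hx => by
        have := hextn x hx
        by_cases hxw : x = w
        · simp [hxw] at this
        · exact ⟨by simpa [hxw] using this, hxw⟩
      have hold : ∀ x, s.num x ≠ 0 → Function.update s.num w (s.clock + 1) x ≠ 0 := fun x hx => by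
        rwa [Function.update_of_ne]
        rintro rfl
        exact hx hw
      have hp2 : potential G s₂ ≤ potential G s + 30 := by
        refine hp.trans ?_
        simp only [potential, reserve, List.length_cons] at hU ⊢
        omega
      simp only [lower, run_bind, run_rd, run_wr]
      split_ifs with hlow
      · have hvo2 : ¬ Owned s₂.cluster s₂.kids s₂.cnt v := fun ho =>
          hvo (hl.owned v (hold v hv) ho)
        rw [run_bind]
        refine (run_closeCluster (G := G) (s := { s₂ with
          time := s₂.time + 1 + 1 + 1
          low := Function.update s₂.low v (min (s₂.low v) (s₂.low w)) }) h2 hext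
          (fun hx => hv (hnew v hx).1) hvw hvo2).imp fun _ s₃ ⟨h3, hst, hnum, ho, hch, hp3⟩ => ?_
        refine tail s₃ h3 ⟨fun x hx => ?_, ⟨[], by simpa using hst, by simp [treeEnds]⟩,
          fun x hx ho3 => ?_, hch.trans hl.chosen⟩ ?_
        · rw [hnum]
          exact hl.num x (hold x hx)
        · rcases ho x ho3 with ho3 | ho3 | rfl
          · exact hl.owned x (hold x hx) ho3
          · exact absurd (hnew x ho3).1 hx
          · exact absurd hw hx
        · refine hp3.trans ?_
          simp only [potential] at hp2 ⊢
          omega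
      -- The edge to `w` stays on the stack; its end was undiscovered in `s`, as `Later` demands.
      · refine tail _ h2 ⟨fun x hx => hl.num x (hold x hx),
          ⟨ext ++ [⟨v, w, true⟩], by simpa using hext, fun x hx => ?_⟩,
          fun x hx ho => hl.owned x (hold x hx) ho, hl.chosen⟩ ?_
        · rw [treeEnds_append, List.mem_append] at hx
          rcases hx with hx | hx
          · exact (hnew x hx).1
          · have : x = w := by simpa [treeEnds] using hx
            rw [this, hw]
        · simp only [potential] at hp2 ⊢
          omega
    · simp only [push, lower, run_bind, run_rd, run_wr]
      refine tail _ (h.push_back v w) ⟨fun _ h => h, ⟨[⟨v, w, false⟩], rfl, by simp [treeEnds]⟩,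
        fun _ _ h => h, rfl⟩ ?_
      simp only [potential, List.length_cons]
      omega
    · refine tail _ h ⟨fun _ h => h, ⟨[], rfl, by simp [treeEnds]⟩, fun _ _ h => h, rfl⟩ ?_
      simp only [potential]
      omega

theorem run_chooseRoot {s : Mem n m} (h : Searching s) {r : Node n m} (hr : s.num r ≠ 0)
    (hrs : r ∉ treeEnds s.stack) (hro : ¬ Owned s.cluster s.kids s.cnt r) :
    Run (chooseRoot r) s fun _ s' => Searching s' ∧ s'.chosen = s.chosen ∧
      potential G s' ≤ potential G s + 20 := by
  simp only [chooseRoot, run_bind, run_rd]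
  rcases hk : s.kids r with _ | ⟨B, ks⟩
  · simp only [run_bind]
    refine (run_newCluster _ _).imp fun B s₂ ⟨hB, nb₂, t₂, c, hs₂, hc, ht₂⟩ => ?_
    have h1 : accNodes (addNode r (([], []) : List (Fin n) × List (Fin m))) = [r] := by
      rcases r with r | r <;> rfl
    rw [h1] at hc ht₂
    simp only [run_wr]
    subst hs₂
    subst hB
    refine ⟨h.isolated hk hr hrs hro hc, rfl, ?_⟩
    dsimp only [List.length_singleton] at ht₂
    simp only [potential, sum_dataSize_update]
    omega
  · simp only [run_bind, run_wr]
    refine ⟨h.promote hk hr hrs hro, trivial, ?_⟩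
    simp only [potential]
    omega

/-- The two steps per entry are the loop step and the test; the reserve of a new start node pays for
its scan and for choosing the root. The stack need not be known to be empty: it suffices that `r` is
not a tree end on it. -/
theorem run_explore (hG : ∀ a ∈ G.nodes, ∀ b ∈ G.nbrs a, b ∈ G.nodes) (rs : List (Node n m))
    (hrs : ∀ r ∈ rs, r ∈ G.nodes) (s : Mem n m) (h : Searching s) :
    Run (explore G rs) s fun _ s' => Searching s' ∧ s'.chosen = s.chosen ∧
      potential G s' ≤ potential G s + 2 * rs.length + 1 := by
  induction rs generalizing s with
  | nil =>
    rw [explore, run_tick]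
    refine ⟨h, rfl, ?_⟩
    simp only [potential, List.length_nil]
    omega
  | cons r rs ih =>
    have hrG := hrs r (by simp)
    have ih := ih fun x hx => hrs x (by simp [hx])
    rw [explore]
    simp only [run_bind, run_tick, run_rd]
    split_ifs with hr
    · have hU := unexplored_update hrG hr s.clock
      simp only [discover, run_bind, run_rd, run_wr]
      refine (run_scan hG (unexplored G (Function.update s.num r (s.clock + 1))) (G.nbrs r) none r _
        ?_ (hG r hrG) ?_ ?_ ?_).imp ?_
      · exact le_rfl
      · simp
      · exact fun ho => h.owned_discovered r ho hr
      · exact h.discover r s.clock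
      rintro _ s₂ ⟨h2, hl, hp⟩
      obtain ⟨ext, hext, hextn⟩ := hl.stack
      have hr₁ : Function.update s.num r (s.clock + 1) r ≠ 0 := by simp
      refine (run_chooseRoot (G := G) h2 (hl.num r hr₁) (fun hx => ?_)
        (fun ho => h.owned_discovered r (hl.owned r hr₁ ho) hr)).imp fun _ s₃ ⟨h3, hch, hp3⟩ => ?_
      · rw [hext, treeEnds_append, List.mem_append] at hx
        rcases hx with hx | hx
        · exact hr₁ (hextn r hx)
        · exact h.ends_discovered r hx hr
      · refine (ih s₃ h3).imp fun _ s₄ ⟨h4, hch4, hp4⟩ =>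
          ⟨h4, hch4.trans (hch.trans hl.chosen), ?_⟩
        simp only [potential, reserve, List.length_cons] at hU hp hp3 hp4 ⊢
        omega
    · refine (ih _ ?_).imp ?_
      · exact h
      rintro _ s₄ ⟨h4, hch4, hp4⟩
      refine ⟨h4, hch4, ?_⟩
      simp only [potential, List.length_cons] at hp4 ⊢
      omega

/-- On blank memory the initial values are already present, so only the time changes. -/
theorem run_allocate_forM (l : List (Node n m)) (t : ℕ) :
    Run (l.forM allocate) { Mem.blank n m with time := t } fun _ s' =>
      ∃ t', s' = { Mem.blank n m with time := t' } ∧ t' ≤ t + 5 * l.length := by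
  induction l generalizing t with
  | nil => exact ⟨_, _, rfl, t, rfl, by simp⟩
  | cons a l ih =>
    have hup : ∀ {α β : Type} [DecidableEq α] (a : α) (b : β),
        Function.update (fun _ : α => b) a b = fun _ => b := fun a b => by
      funext x; simp [Function.update_apply]
    change Run (allocate a >>= fun _ => l.forM allocate) _ _
    rcases a with v | c <;>
      simp only [allocate, run_bind, run_wr, Mem.blank, hup, List.length_cons]
    · exact (ih _).imp fun _ s' ⟨t', h1, h2⟩ => ⟨t', h1, by omega⟩
    · exact (ih _).imp fun _ s' ⟨t', h1, h2⟩ => ⟨t', h1, by omega⟩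

theorem searching_blank (t : ℕ) : Searching { Mem.blank n m with time := t } := by
  have hno : ∀ x, ¬ Owned (n := n) (m := m) (fun _ => ⟨[], []⟩) (fun _ => []) 0 x :=
    fun x ⟨B, hB, _⟩ => absurd hB (Nat.not_lt_zero B)
  exact ⟨⟨by simp [Mem.blank], by simp [Mem.blank], by simp [Mem.blank], by simp [Mem.blank],
    by simp [Mem.blank], by simp [Mem.blank], by simp [Mem.blank], by simp [Mem.blank],
    by simp [Mem.blank]⟩, fun x hx => absurd hx (hno x), fun x hx => absurd hx (hno x),
    by simp [Mem.blank, treeEnds], by simp [Mem.blank, treeEnds]⟩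

/-- The decomposition into clusters takes linear time, and yields a forest with data of linear
size. -/
theorem run_clusterForest (hG : ∀ a ∈ G.nodes, ∀ b ∈ G.nbrs a, b ∈ G.nodes) :
    Run (clusterForest G) (Mem.blank n m) fun _ s =>
      IsForest s.cluster s.kids s.roots s.cnt ∧ s.chosen = (fun _ => []) ∧
      s.time + ∑ B ∈ Finset.range s.cnt, dataSize (s.cluster B) ≤
        50 * G.nodes.length + 60 * (G.nodes.map fun x => (G.nbrs x).length).sum + 1 := by
  rw [clusterForest, run_bind]
  refine (run_allocate_forM G.nodes 0).imp fun _ s ⟨t, hs, ht⟩ => ?_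
  subst hs
  refine (run_explore hG G.nodes (fun _ h => h) _ (searching_blank t)).imp ?_
  rintro _ s' ⟨h1, h2, h3⟩
  refine ⟨h1.toIsForest, h2, ?_⟩
  have h4 : unexplored G (fun _ => 0) =
      60 * (G.nodes.map fun x => (G.nbrs x).length).sum + 40 * G.nodes.length := by
    simp [unexplored, reserve, List.sum_map_add, List.sum_map_mul_left, mul_comm]
  simp only [potential, Mem.blank, List.length_nil, Finset.range_zero, Finset.sum_empty, nbSize,
    Finset.sum_const_zero, h4] at h3
  omega

end RAM

/-! ### Size of the residual graph -/

section

variable {n m : ℕ} {H : Matrix (Fin m) (Fin n) Bit} {ε : Finset (Fin n)} {G : AdjList (Node n m)}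

/-- The neighbour lists of a residual Tanner graph contain every edge at most twice. -/
theorem AdjList.Represents.sum_length_nbrs_le (h : G.Represents (variableInduced H ε)) :
    (G.nodes.map fun x => (G.nbrs x).length).sum ≤ 2 * (tannerGraph H).edgeSet.ncard := by
  classical
  have h1 : ∀ x, (G.nbrs x).length ≤ (tannerGraph H).degree x := fun x => by
    rw [← List.toFinset_card_of_nodup (h.nbrs_nodup x), ← SimpleGraph.card_neighborFinset_eq_degree]
    refine Finset.card_le_card fun y hy => ?_
    rw [List.mem_toFinset, h.mem_nbrs] at hy
    rw [SimpleGraph.mem_neighborFinset]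
    exact hy.adj_sub
  rw [← List.sum_toFinset _ h.nodes_nodup, Set.ncard_eq_toFinset_card',
    ← SimpleGraph.edgeFinset, ← SimpleGraph.sum_degrees_eq_twice_card_edges]
  exact (Finset.sum_le_sum fun x _ => h1 x).trans
    (Finset.sum_le_sum_of_subset (Finset.subset_univ _))

/-- Every check node of a residual Tanner graph is the end of an edge. -/
theorem AdjList.Represents.length_nodes_le (h : G.Represents (variableInduced H ε)) :
    G.nodes.length ≤ n + 2 * (tannerGraph H).edgeSet.ncard := by
  classical
  have h1 : ∀ c, Sum.inr c ∈ G.nodes → 1 ≤ (tannerGraph H).degree (Sum.inr c) := fun c hc => by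
    rw [h.mem_nodes] at hc
    rcases hc with ⟨v, _, hv⟩ | ⟨v, _, hv⟩
    · exact absurd hv (by simp)
    · exact (SimpleGraph.degree_pos_iff_exists_adj _ _).2 ⟨_, hv.symm⟩
  -- Summing the constant 1 counts the variable nodes and the check nodes of the list separately.
  have h0 := RAM.sum_map_eq_sum_ite h.nodes_nodup (S := Finset.univ) (by simp) fun _ => 1
  rw [List.map_const', List.sum_replicate, smul_eq_mul, mul_one, Fintype.sum_sum_type] at h0
  rw [h0, Set.ncard_eq_toFinset_card', ← SimpleGraph.edgeFinset,
    ← SimpleGraph.sum_degrees_eq_twice_card_edges, Fintype.sum_sum_type]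
  have h2 : ∑ v : Fin n, (if (Sum.inl v : Node n m) ∈ G.nodes then 1 else 0) ≤ n := by
    refine (Finset.sum_le_card_nsmul _ _ 1 fun v _ => by split_ifs <;> simp).trans (by simp)
  have h3 : ∑ c : Fin m, (if (Sum.inr c : Node n m) ∈ G.nodes then 1 else 0) ≤
      ∑ c : Fin m, (tannerGraph H).degree (Sum.inr c) := by
    refine Finset.sum_le_sum fun c _ => ?_
    split_ifs with hc
    · exact h1 c hc
    · exact Nat.zero_le _
  omega

theorem AdjList.Represents.mem_nodes_of_mem_nbrs (h : G.Represents (variableInduced H ε)) :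
    ∀ a ∈ G.nodes, ∀ b ∈ G.nbrs a, b ∈ G.nodes := fun a _ b hb =>
  (h.mem_nodes b).2 ((h.mem_nbrs a b).1 hb).snd_mem

end

/-! ### Total running time -/

namespace RAM

/-- The decoder halts within a time which is linear in the size of the graph, times `C ^ 2 + 1`. -/
theorem run_constrainedClusterDecoder {n m : ℕ} {G : AdjList (Node n m)}
    (hG : ∀ a ∈ G.nodes, ∀ b ∈ G.nbrs a, b ∈ G.nodes) (s : Fin m → Bit) (C D : ℕ)
    (hD : 50 * G.nodes.length + 60 * (G.nodes.map fun x => (G.nbrs x).length).sum + 1 ≤ D) :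
    Run (constrainedClusterDecoder G s C) (Mem.blank n m) fun _ s' =>
      s'.time ≤ 2000 * ((C ^ 2 + 1) * D) + 8 * D + n + 6 := by
  rw [constrainedClusterDecoder, run_bind]
  refine (run_clusterForest hG).imp fun _ s₁ ⟨hF, hch, ht⟩ => ?_
  rw [run_bind, run_rd]
  set S := ∑ B ∈ Finset.range s₁.cnt, dataSize (s₁.cluster B) with hSdef
  -- After the decomposition the forest is final, so `Frame` is instantiated with the contents of
  -- the memory at this moment.
  have key : Within (Frame s₁.cluster s₁.kids s₁.roots)
      (2000 * ((C ^ 2 + 1) * S) + 7 * S + n + 4) (do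
        let large ← existsLarger C s₁.cnt
        if large then
          pure Outcome.failure
        else do
          let rts ← rd (·.roots)
          rts.forM fun B => do
            recursiveCompute s none B
            recursiveSelect s none B 0
          (List.finRange n).forM fun i => wr fun s => { s with out := Function.update s.out i 0 }
          merge s₁.cnt
          let x ← rd (·.out)
          pure (Outcome.success x)) fun _ => True := by
    refine ((within_existsLarger C s₁.cnt).bind
      (k₂ := 2000 * ((C ^ 2 + 1) * S) + 3 * S + n + 3) fun large hl => ?_).mono (by omega)
    refine .ite (fun _ => (Within.pure trivial).mono (by omega)) fun hlarge => ?_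
    refine ((within_rd (P := (· = s₁.roots)) fun s hs => hs.2.2.1).bind
      (k₂ := 2000 * ((C ^ 2 + 1) * S) + 3 * S + n + 2) fun rts hrts => ?_).mono (by omega)
    subst hrts
    refine ((hF.within_recursiveCompute_forM s C (hl (by simpa using hlarge))).bind fun _ _ =>
      (Within.forM (c := fun _ => 1) fun i _ =>
        within_wr (by intro; rfl) (by intro _ h; exact h)).bind fun _ _ =>
      (within_merge s₁.cnt).bind fun _ _ => .rd_bind (k := 0) fun x => .pure trivial).mono ?_
    simp only [List.map_const', List.sum_replicate, List.length_finRange, smul_eq_mul, ← hSdef]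
    omega
  obtain ⟨a, s₂, h1, -, h2, -⟩ := key { s₁ with time := s₁.time + 1 }
    ⟨rfl, rfl, rfl, fun B => by simp [hch]⟩
  refine ⟨a, s₂, h1, h2.trans ?_⟩
  have hS : S ≤ D := by omega
  have := Nat.mul_le_mul_left (C ^ 2 + 1) hS
  dsimp only
  omega

end RAM

theorem theorem2 (K : ℕ) :
    ∃ A A' : ℕ, ∀ (n m : ℕ) (H : Matrix (Fin m) (Fin n) Bit) (ε : Finset (Fin n))
      (G : AdjList (Node n m)) (s : Fin m → Bit) (C : ℕ),
      0 < n →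
      (tannerGraph H).edgeSet.ncard ≤ K * n →
      G.Represents (variableInduced H ε) →
      ∃ (result : Outcome n) (t : ℕ),
        (constrainedClusterDecoder G s C).HaltsIn result t ∧
          t ≤ A * (n * C ^ 2) + A' * n := by
  -- With at most `n + 2 * K * n` nodes and total list length at most `2 * K * n`, the linear bound
  -- is `50 * n + 220 * K * n + 1`; the last 1 is absorbed by `n`, which gives 51. Then 2008 is 2000
  -- plus 8, and 7 absorbs `n + 6`.
  refine ⟨2000 * (220 * K + 51), 2008 * (220 * K + 51) + 7, fun n m H ε G s C hn hE hG => ?_⟩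
  have h1 := hG.length_nodes_le
  have h2 := hG.sum_length_nbrs_le
  obtain ⟨result, s', hrun, ht⟩ := RAM.run_constrainedClusterDecoder hG.mem_nodes_of_mem_nbrs s C
    (220 * (K * n) + 51 * n) (by omega)
  refine ⟨result, s'.time, ⟨s', hrun, rfl⟩, ht.trans ?_⟩
  calc _ = 2000 * (220 * K + 51) * (n * C ^ 2) + 2008 * (220 * K + 51) * n + n + 6 := by ring
    _ ≤ _ := by rw [add_mul]; omega
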